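/- **Setting.** Let $d\ge 2$ (the physical cases are $d=2,3$), let $b_1,\dots,b_d$ be a basis of $\mathbb{R}^d$, and let $\mathcal V$ be the corresponding period cell, with average $\langle f\rangle=|\mathcal V|^{-1}\int_{\mathcal V}f$; $L^2(\mathcal V)$ carries the norm $\langle f^2\rangle^{1/2}$. For moduli $\kappa,\mu\in L^\infty_{\rm per}(\mathcal V)$ with positive values and a symmetric matrix $\bar\varepsilon$, a *strain field solution* is a periodic field of the form $\varepsilon=\bar\varepsilon+\nabla_s u$ with $u\in H^1_{\rm per}(\mathcal V,\mathbb{R}^d)$ (so $\langle\varepsilon\rangle=\bar\varepsilon$) such that the stress $\sigma=\kappa\,\mathrm{tr}[\varepsilon]\,I+2\mu\,\mathrm{dev}[\varepsilon]$ satisfies $\nabla\cdot\sigma=0$ weakly against smooth periodic test functions. Here $\mathrm{dev}[\varepsilon]=\varepsilon-\frac1d\mathrm{tr}[\varepsilon]I$, $\|\bar\varepsilon\|^2=\sum_{ij}\bar\varepsilon_{ij}^2$, $\varepsilon_0=\frac1d\mathrm{tr}[\varepsilon]$ is the hydrostatic strain and $\varepsilon_{\rm eq}=\big(\frac{d-1}{d}\,\mathrm{dev}[\varepsilon]:\mathrm{dev}[\varepsilon]\big)^{1/2}$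 the equivalent strain. Fix reference moduli $\kappa_0,\mu_0>0$ and put $$\|\delta\mathcal L\|=\operatorname{ess\,sup}_{x\in\mathcal V}\max\big(|d(\kappa(x)-\kappa_0)|,\,|2(\mu(x)-\mu_0)|\big).$$ **Proposition 1.** Let $\bar\varepsilon\ne0$ be purely spherical, i.e. $\bar\varepsilon=\frac1d\mathrm{tr}[\bar\varepsilon]I$, and let $\varepsilon$ be a strain field solution associated with $\bar\varepsilon$. If $\langle\kappa\rangle=\kappa_0$, then, to first order in the weak-contrast limit $\|\delta\mathcal L\|\to0$, $$\kappa(x)=\kappa_0+\frac{\lambda_J^{-1}}{d}\Big[1-\frac{\mathrm{tr}[\varepsilon(x)]\,\mathrm{tr}[\bar\varepsilon]}{d\,\|\bar\varepsilon\|^2}\Big]+o(\|\delta\mathcal L\|),\qquad \lambda_J^{-1}=d\kappa_0+2(d-1)\mu_0,$$ and likewise $$\kappa(x)=\kappa_0+\frac{\lambda_J^{-1}}{d}\Big[1-\frac{\varepsilon_0(x)}{\bar\varepsilon_0}\Big]+o(\|\delta\mathcal L\|).$$ Moreover, whether or not $\langle\kappa\rangle=\kappa_0$, one has $\varepsilon_{\rm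 eq}(x)=O(\|\delta\mathcal L\|)$. These asymptotics hold in each of the following two senses. 1. *In $L^2(\mathcal V)$, uniformly over media.* For every $\eta>0$ there is $r>0$ such that, for all $\kappa,\mu$ as above with $\langle\kappa\rangle=\kappa_0$ and $\|\delta\mathcal L\|\le r$ and every strain field solution, both remainders written $o(\|\delta\mathcal L\|)$ have $L^2(\mathcal V)$ norm at most $\eta\|\delta\mathcal L\|$; and there are $C$ and $r>0$ such that the $L^2(\mathcal V)$ norm of $\varepsilon_{\rm eq}$ is at most $C\|\delta\mathcal L\|$ for all $\kappa,\mu$ as above with $\|\delta\mathcal L\|\le r$ and every strain field solution. The numbers $r$ and $C$ do not depend on $\kappa,\mu$. 2. *At almost every point, for scaled fluctuations.* Let $k,m\in L^\infty_{\rm per}(\mathcal V)$, let $t_n\to0$ be a real sequence, and let $\varepsilon^{(n)}$ be strain field solutions for $\kappa_n=\kappa_0+t_nk$, $\mu_n=\mu_0+t_nm$. Then, for almost every $x\in\mathcal V$, $\varepsilon^{(n)}_{\rm eq}(x)=O(\|\delta\mathcal L_n\|)$ and, if $\langle k\rangle=0$, both expansions of $\kappa_n(x)$ hold with a remainder $o(\|\delta\mathcal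 L_n\|)$ as $n\to\infty$. -/

import Mathlib

open MeasureTheory Filter Topology Asymptotics
open scoped ContDiff

namespace PeriodicElasticity

noncomputable section

/-- The physical space `ℝ^d`, with its Euclidean norm and Lebesgue measure. -/
abbrev Space (d : ℕ) := EuclideanSpace ℝ (Fin d)

/-- Second-order tensors on `ℝ^d`. -/
abbrev Tensor2 (d : ℕ) := Matrix (Fin d) (Fin d) ℝ

/-! ### Tensor algebra -/

/-- The doubly contracted product `A : B`; in particular `‖A‖² = A : A`. -/
def ddot {d : ℕ} (A B : Tensor2 d) : ℝ := ∑ i, ∑ j, A i j * B i j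

/-- Action of the spherical projector, `J : τ = (1/d) tr[τ] I`. -/
def sph {d : ℕ} (τ : Tensor2 d) : Tensor2 d := (τ.trace / (d : ℝ)) • (1 : Tensor2 d)

/-- Action of the deviatoric projector, `K : τ = τ - (1/d) tr[τ] I`. -/
def dev {d : ℕ} (τ : Tensor2 d) : Tensor2 d := τ - sph τ

/-- Action of the isotropic elasticity tensor `d κ J + 2 μ K` on a strain. -/
def stress {d : ℕ} (κ μ : ℝ) (e : Tensor2 d) : Tensor2 d :=
  ((d : ℝ) * κ) • sph e + (2 * μ) • dev e

/-- The hydrostatic strain `(1/d) tr[e]`. -/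
def hydrostatic {d : ℕ} (e : Tensor2 d) : ℝ := e.trace / (d : ℝ)

/-- The Von Mises equivalent strain `(((d-1)/d) dev[e] : dev[e])^{1/2}`. -/
def equivalentStrain {d : ℕ} (e : Tensor2 d) : ℝ :=
  Real.sqrt ((((d : ℝ) - 1) / (d : ℝ)) * ddot (dev e) (dev e))

/-! ### Periodic fields

The lattice is `⨁ ℤ b_i` for a basis `b` of `ℝ^d`. -/

/-- The period cell `𝒱 = {∑ yᵢ bᵢ : 0 ≤ yᵢ < 1}`. -/
def cell {d : ℕ} (b : Module.Basis (Fin d) ℝ (Space d)) : Set (Space d) :=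
  ZSpan.fundamentalDomain b

/-- Lebesgue measure on the cell divided by `|𝒱|`, so that the average `⟨f⟩` is the integral of `f`
against it. -/
def cellMeasure {d : ℕ} (b : Module.Basis (Fin d) ℝ (Space d)) : Measure (Space d) :=
  (volume (cell b))⁻¹ • volume.restrict (cell b)

/-- Invariance under the translations of the lattice. -/
def LatticePeriodic {d : ℕ} {α : Type*} (b : Module.Basis (Fin d) ℝ (Space d))
    (f : Space d → α) : Prop :=
  ∀ i x, f (x + b i) = f x

/-- Real-valued functions in `L^p_per(𝒱)`. -/
def LpPer {d : ℕ} (b : Module.Basis (Fin d) ℝ (Space d)) (p : ENNReal) (f : Space d → ℝ) : Prop :=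
  LatticePeriodic b f ∧ MemLp f p (cellMeasure b)

/-- Smooth periodic test functions. -/
def IsTest {d : ℕ} (b : Module.Basis (Fin d) ℝ (Space d)) (φ : Space d → ℝ) : Prop :=
  LatticePeriodic b φ ∧ ContDiff ℝ ∞ φ

/-- The classical partial derivative `∂_j φ`. -/
def partialDeriv {d : ℕ} (j : Fin d) (φ : Space d → ℝ) (x : Space d) : ℝ :=
  fderiv ℝ φ x (EuclideanSpace.single j 1)

/-- `g` is the weak partial derivative `∂_j f` of the periodic function `f`. -/
def HasWeakPartial {d : ℕ} (b : Module.Basis (Fin d) ℝ (Space d)) (j : Fin d)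
    (f g : Space d → ℝ) : Prop :=
  ∀ φ, IsTest b φ →
    ∫ x, f x * partialDeriv j φ x ∂(cellMeasure b) = - ∫ x, g x * φ x ∂(cellMeasure b)

/-! ### The periodic elasticity problem -/

/-- `e = ē + ∇ₛ u` for some periodic displacement `u ∈ H¹_per(𝒱, ℝ^d)`; this forces `⟨e⟩ = ē`. -/
def IsCompatible {d : ℕ} (b : Module.Basis (Fin d) ℝ (Space d)) (ebar : Tensor2 d)
    (e : Space d → Tensor2 d) : Prop :=
  ∃ (u : Fin d → Space d → ℝ) (G : Fin d → Fin d → Space d → ℝ),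
    (∀ i, LpPer b 2 (u i)) ∧
    (∀ i j, LpPer b 2 (G i j) ∧ HasWeakPartial b j (u i) (G i j)) ∧
    ∀ᵐ x ∂(cellMeasure b), ∀ i j, e x i j = ebar i j + (G i j x + G j i x) / 2

/-- Weak form of `∇ · σ = 0` on the periodic cell; taking periodic test functions encodes the
anti-periodicity of the tractions `σ · n` on the boundary of the cell. -/
def IsEquilibrated {d : ℕ} (b : Module.Basis (Fin d) ℝ (Space d))
    (σ : Space d → Tensor2 d) : Prop :=
  ∀ i, ∀ φ, IsTest b φ → ∫ x, ∑ j, σ x i j * partialDeriv j φ x ∂(cellMeasure b) = 0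

/-- `e` is a strain field solution of the periodic elasticity problem for the moduli `κ`, `μ` and
the macroscopic strain `ē`. -/
def IsStrainSolution {d : ℕ} (b : Module.Basis (Fin d) ℝ (Space d)) (κ μ : Space d → ℝ)
    (ebar : Tensor2 d) (e : Space d → Tensor2 d) : Prop :=
  LatticePeriodic b e ∧ IsCompatible b ebar e ∧
    IsEquilibrated b (fun x => stress (κ x) (μ x) (e x))

/-- Bulk and shear moduli `κ, μ ∈ L^∞_per(𝒱)` with positive values. -/
def IsMedium {d : ℕ} (b : Module.Basis (Fin d) ℝ (Space d)) (κ μ : Space d → ℝ) : Prop :=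
  LpPer b ⊤ κ ∧ LpPer b ⊤ μ ∧ ∀ᵐ x ∂(cellMeasure b), 0 < κ x ∧ 0 < μ x

/-- The contrast `‖δL‖ = sup_x max (|d (κ(x) - κ₀)|, |2 (μ(x) - μ₀)|)` (essential supremum). -/
def contrast {d : ℕ} (b : Module.Basis (Fin d) ℝ (Space d)) (κ₀ μ₀ : ℝ)
    (κ μ : Space d → ℝ) : ℝ :=
  (eLpNorm (fun x => max |(d : ℝ) * (κ x - κ₀)| |2 * (μ x - μ₀)|) ⊤ (cellMeasure b)).toReal

/-! ### Reconstruction formulae for the bulk modulus -/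

/-- `λ_J⁻¹ = d κ₀ + 2 (d - 1) μ₀`. -/
def lamJInv (d : ℕ) (κ₀ μ₀ : ℝ) : ℝ := (d : ℝ) * κ₀ + 2 * ((d : ℝ) - 1) * μ₀

/-- `κ₀ + (λ_J⁻¹ / d) [1 - tr[e] tr[ē] / (d ‖ē‖²)]`, for the local strain `e`. -/
def bulkFromTrace {d : ℕ} (κ₀ μ₀ : ℝ) (ebar e : Tensor2 d) : ℝ :=
  κ₀ + lamJInv d κ₀ μ₀ / (d : ℝ) * (1 - e.trace * ebar.trace / ((d : ℝ) * ddot ebar ebar))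

/-- `κ₀ + (λ_J⁻¹ / d) [1 - e₀ / ē₀]`, with `e₀`, `ē₀` the hydrostatic strains. -/
def bulkFromHydrostatic {d : ℕ} (κ₀ μ₀ : ℝ) (ebar e : Tensor2 d) : ℝ :=
  κ₀ + lamJInv d κ₀ μ₀ / (d : ℝ) * (1 - hydrostatic e / hydrostatic ebar)

end

end PeriodicElasticity

open PeriodicElasticity

/-! Write `ebar = a I` and split the strain as `a I + w`, where `w` is a symmetrized gradient. Let
`L₀` be the elasticity operator with the reference moduli, `δL` the one with the fluctuations `k`,
`m` of the moduli, and `K` the closed space of compatible fields. Constant stresses are orthogonal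
to `K`, so equilibrium says that `L₀ w + δL (a I) + δL w` is orthogonal to `K`
(`exists_fluctuation`). Since `I` is spherical, `δL (a I)` is the scalar field `g = d a k` times
`I`: the shear fluctuation does not enter at first order.

Two estimates carry the result. Testing with `w` itself and using the coercivity of `L₀` gives `‖w‖
= O(‖δL‖)`; the equivalent strain ignores the spherical part `a I`, so it has this order too.
Testing with the modes `ξ ⊗ ξ exp(2πi ξ·x)` isolates the trace: `L₀ w` contributes `|ξ|² (λ_J⁻¹/d)`
times the coefficient of `tr w`, and `g I` contributes `|ξ|²` times that of `g`. By Cauchy-Schwarz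
and Parseval, `(λ_J⁻¹/d) tr w + g` is bounded in norm by `δL w`, which is of second order
(`norm_traceOp_add_le`). This quantity is `d a` times the error of the reconstruction formula; the
condition on the mean of `κ` is what settles the zero frequency.

For scaled fluctuations `t k`, `t m`, let `S` be the solution operator of the reference problem and
`N = S δL`. The strain satisfies `W = E + t N W` with `E = a I`, hence is a Neumann series in `t`.
Its terms have summable `L²` norms, so it converges at almost every point, with a second-order
remainder bounded by `t² G(x)`. The trace estimate without remainder stress identifies the trace of
the first-order term `N E` exactly. -/

namespace PeriodicElasticity

noncomputable section

/-! ### Fourier basis of the period cell -/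

section FourierBasis

/-- Normalized Haar measure on the circle. -/
local instance : MeasureSpace UnitAddCircle := ⟨AddCircle.haarAddCircle⟩

local instance : Measure.IsAddHaarMeasure (volume : Measure UnitAddCircle) :=
  inferInstanceAs (Measure.IsAddHaarMeasure AddCircle.haarAddCircle)

local instance : IsProbabilityMeasure (volume : Measure UnitAddCircle) :=
  inferInstanceAs (IsProbabilityMeasure AddCircle.haarAddCircle)

variable {d : ℕ} (b : Module.Basis (Fin d) ℝ (Space d))

/-- The phase `2π ∑ nᵢ yᵢ` at the point `∑ yᵢ bᵢ`. -/
def phase (n : Fin d → ℤ) (x : Space d) : ℝ := 2 * Real.pi * ∑ i, (n i : ℝ) * b.repr x i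

lemma repr_equivFun_symm (y : Fin d → ℝ) (i : Fin d) : b.repr (b.equivFun.symm y) i = y i := by
  rw [← b.equivFun_apply, LinearEquiv.apply_symm_apply]

/-- The point of the period cell which represents a point of the torus. -/
def torusLift (y : UnitAddTorus (Fin d)) : Space d :=
  b.equivFun.symm fun i => (AddCircle.equivIoc 1 0 (y i)).1

lemma volume_cell_ne_zero : volume (cell b) ≠ 0 := ZSpan.measure_fundamentalDomain_ne_zero b

lemma volume_cell_ne_top : volume (cell b) ≠ ⊤ :=
  (ZSpan.fundamentalDomain_isBounded b).measure_lt_top.ne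

instance : IsProbabilityMeasure (cellMeasure b) := by
  constructor
  simp [cellMeasure, ENNReal.inv_mul_cancel (volume_cell_ne_zero b) (volume_cell_ne_top b)]

/-- A linear isomorphism carries Lebesgue measure to a Haar measure, hence to a multiple of Lebesgue
measure; the factor is fixed because the cell is the image of a unit cube. -/
lemma map_restrict_cube :
    (volume.restrict (Set.univ.pi fun _ : Fin d => Set.Ioc (0 : ℝ) (0 + 1))).map b.equivFun.symm
      = cellMeasure b := by
  have hm : Measurable b.equivFun.symm :=
    (b.equivFun.symm.toLinearMap.continuous_of_finiteDimensional).measurable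
  -- The torus is parametrized by `Ioc` and the cell by `Ico`; they differ by a null set.
  have hs : (Set.univ.pi fun _ : Fin d => Set.Ioc (0 : ℝ) (0 + 1)) =ᵐ[volume]
      (Set.univ.pi fun _ : Fin d => Set.Ico (0 : ℝ) (0 + 1)) :=
    (Measure.univ_pi_Ioc_ae_eq_Icc (μ := fun _ => volume)).trans
      (Measure.univ_pi_Ico_ae_eq_Icc (μ := fun _ => volume)).symm
  rw [Measure.restrict_congr_set hs]
  have hc : (Set.univ.pi fun _ : Fin d => Set.Ico (0 : ℝ) (0 + 1))
      = b.equivFun.symm ⁻¹' cell b := by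
    ext y
    simp only [cell, Set.mem_preimage, ZSpan.mem_fundamentalDomain, repr_equivFun_symm]
    simp
  have hcell : MeasurableSet (cell b) := ZSpan.fundamentalDomain_measurableSet b
  rw [hc, ← Measure.restrict_map hm hcell]
  have : (Measure.map b.equivFun.symm (volume : Measure (Fin d → ℝ))).IsAddHaarMeasure :=
    b.equivFunL.symm.isAddHaarMeasure_map volume
  have hu := Measure.isAddLeftInvariant_eq_smul
    (Measure.map b.equivFun.symm (volume : Measure (Fin d → ℝ))) (volume : Measure (Space d))
  set c := Measure.addHaarScalarFactor
    (Measure.map b.equivFun.symm (volume : Measure (Fin d → ℝ))) (volume : Measure (Space d))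
  have h1 : (c : ENNReal) * volume (cell b) = 1 := by
    have : (Measure.map b.equivFun.symm (volume : Measure (Fin d → ℝ))) (cell b) = 1 := by
      rw [Measure.map_apply hm hcell, ← hc, Real.volume_pi_Ico]
      simp
    rw [hu] at this
    simpa using this
  rw [hu, cellMeasure, Measure.restrict_smul]
  rw [show (volume (cell b))⁻¹ = (c : ENNReal) from (ENNReal.eq_inv_of_mul_eq_one_left h1).symm]
  rfl

lemma measurePreserving_torusLift :
    MeasurePreserving (torusLift b) volume (cellMeasure b) := by
  have h1 := UnitAddTorus.measurePreserving_equivPiIoc (fun _ : Fin d => (0 : ℝ))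
  have hms : MeasurableSet {x : Fin d → ℝ | ∀ i, x i ∈ Set.Ioc (0 : ℝ) (0 + 1)} := by
    have := MeasurableSet.univ_pi (fun _ : Fin d => measurableSet_Ioc (a := (0 : ℝ)) (b := 0 + 1))
    convert this using 1
    ext x; simp
  have h2 : MeasurePreserving (Subtype.val : {x : Fin d → ℝ | ∀ i, x i ∈ Set.Ioc (0 : ℝ) (0 + 1)} → _)
      (Measure.comap Subtype.val volume)
      (volume.restrict {x : Fin d → ℝ | ∀ i, x i ∈ Set.Ioc (0 : ℝ) (0 + 1)}) :=
    ⟨measurable_subtype_coe, map_comap_subtype_coe hms _⟩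
  have h3 : MeasurePreserving b.equivFun.symm
      (volume.restrict {x : Fin d → ℝ | ∀ i, x i ∈ Set.Ioc (0 : ℝ) (0 + 1)}) (cellMeasure b) := by
    refine ⟨(b.equivFun.symm.toLinearMap.continuous_of_finiteDimensional).measurable, ?_⟩
    rw [← map_restrict_cube b]
    congr 2
    ext x; simp
  exact h3.comp (h2.comp h1)

lemma mFourier_eq_exp_phase (n : Fin d → ℤ) (y : UnitAddTorus (Fin d)) :
    UnitAddTorus.mFourier n y = Complex.exp (phase b n (torusLift b y) * Complex.I) := by
  have hy : ∀ i, y i = (((AddCircle.equivIoc 1 0 (y i)).1 : ℝ) : UnitAddCircle) := fun i =>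
    ((AddCircle.equivIoc (1 : ℝ) 0).symm_apply_apply (y i)).symm
  have hr : ∀ i, b.repr (torusLift b y) i = (AddCircle.equivIoc 1 0 (y i)).1 := fun i =>
    repr_equivFun_symm b _ i
  simp only [UnitAddTorus.mFourier, ContinuousMap.coe_mk, phase, hr]
  rw [Complex.ofReal_mul, Complex.ofReal_sum, Finset.mul_sum, Finset.sum_mul, Complex.exp_sum]
  refine Finset.prod_congr rfl fun i _ => ?_
  conv_lhs => rw [hy i]
  rw [fourier_coe_apply]
  congr 1
  push_cast
  ring

lemma continuous_phase (n : Fin d → ℤ) : Continuous (phase b n) := by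
  have : ∀ i, Continuous fun x => b.repr x i := fun i =>
    (b.coord i).continuous_of_finiteDimensional
  unfold phase
  fun_prop

lemma norm_exp_phase (n : Fin d → ℤ) (x : Space d) :
    ‖Complex.exp (phase b n x * Complex.I)‖ = 1 := Complex.norm_exp_ofReal_mul_I _

lemma memLp_exp_phase (n : Fin d → ℤ) :
    MemLp (fun x => Complex.exp (phase b n x * Complex.I)) 2 (cellMeasure b) := by
  refine MemLp.of_bound (Continuous.aestronglyMeasurable ?_) 1
    (Eventually.of_forall fun x => (norm_exp_phase b n x).le)
  have := continuous_phase b n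
  fun_prop

/-- Pulling back to the torus. -/
def pullback : Lp ℂ 2 (cellMeasure b) →ₗᵢ[ℂ] Lp ℂ 2 (volume : Measure (UnitAddTorus (Fin d))) :=
  Lp.compMeasurePreservingₗᵢ ℂ (torusLift b) (measurePreserving_torusLift b)

/-- The Fourier monomials of the period cell. -/
def monomial (n : Fin d → ℤ) : Lp ℂ 2 (cellMeasure b) := (memLp_exp_phase b n).toLp _

lemma pullback_monomial (n : Fin d → ℤ) :
    pullback b (monomial b n) = UnitAddTorus.mFourierLp 2 n := by
  apply Lp.ext
  refine (Lp.coeFn_compMeasurePreserving _ (measurePreserving_torusLift b)).trans ?_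
  refine EventuallyEq.trans ?_ (UnitAddTorus.coeFn_mFourierLp 2 n).symm
  have := (measurePreserving_torusLift b).quasiMeasurePreserving.ae_eq_comp
    (memLp_exp_phase b n).coeFn_toLp
  refine this.trans (Eventually.of_forall fun y => ?_)
  exact (mFourier_eq_exp_phase b n y).symm

/-- The Hilbert basis of `L²(𝒱)` made of the Fourier monomials. -/
def fourierBasis : HilbertBasis (Fin d → ℤ) ℂ (Lp ℂ 2 (cellMeasure b)) :=
  HilbertBasis.mkOfOrthogonalEqBot (v := monomial b)
    (by
      have h := UnitAddTorus.orthonormal_mFourier (d := Fin d)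
      have : UnitAddTorus.mFourierLp (d := Fin d) 2 = pullback b ∘ monomial b :=
        funext fun n => (pullback_monomial b n).symm
      rw [this] at h
      exact (LinearIsometry.orthonormal_comp_iff (pullback b)).mp h)
    (by
      rw [Submodule.eq_bot_iff]
      intro f hf
      -- Completeness descends from the torus: `pullback b` only has to be isometric and to match
      -- the monomials, not to be onto.
      have h0 : pullback b f ∈
          (Submodule.span ℂ (Set.range (UnitAddTorus.mFourierLp (d := Fin d) 2)))ᗮ := by
        rw [Submodule.mem_orthogonal']
        intro g hg
        induction hg using Submodule.span_induction with
        | mem g hg =>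
          obtain ⟨n, rfl⟩ := hg
          rw [← pullback_monomial, LinearIsometry.inner_map_map]
          exact (Submodule.mem_orthogonal' _ _).mp hf _ (Submodule.subset_span ⟨n, rfl⟩)
        | zero => simp
        | add x y _ _ hx hy => rw [inner_add_right, hx, hy, add_zero]
        | smul c x _ hx => rw [inner_smul_right, hx, mul_zero]
      have h1 := UnitAddTorus.span_mFourierLp_closure_eq_top (d := Fin d) (p := 2) (by simp)
      rw [← Submodule.orthogonal_closure, h1, Submodule.top_orthogonal_eq_bot, Submodule.mem_bot] at h0
      exact (pullback b).injective (by simpa using h0))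

lemma fourierBasis_apply (n : Fin d → ℤ) : fourierBasis b n = (memLp_exp_phase b n).toLp _ := by
  rw [fourierBasis, HilbertBasis.coe_mkOfOrthogonalEqBot, monomial]

end FourierBasis

/-! ### Coercive problems on a closed subspace -/

section Coercive

open scoped InnerProductSpace

variable {H : Type*} [NormedAddCommGroup H] [InnerProductSpace ℂ H]
  {K : Submodule ℂ H} {L : H →L[ℂ] H} {c : ℝ}

/-- Take `v = w` and divide by `‖w‖`. -/
lemma coercive_estimate (hL : ∀ w, c * ‖w‖ ^ 2 ≤ (⟪L w, w⟫_ℂ).re) {w τ : H}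
    (hw : w ∈ K) (h : ∀ v ∈ K, ⟪L w + τ, v⟫_ℂ = 0) : c * ‖w‖ ≤ ‖τ‖ := by
  have h1 := h w hw
  rw [inner_add_left] at h1
  have h2 : (⟪L w, w⟫_ℂ).re = -(⟪τ, w⟫_ℂ).re := by
    have := congrArg Complex.re h1
    simp only [Complex.add_re, Complex.zero_re] at this
    linarith
  have h3 : -(⟪τ, w⟫_ℂ).re ≤ ‖τ‖ * ‖w‖ :=
    (neg_le_abs _).trans ((Complex.abs_re_le_norm _).trans (norm_inner_le_norm τ w))
  have h4 := hL w
  rcases (norm_nonneg w).eq_or_lt with h0 | h0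
  · rw [← h0]; simp
  · refine le_of_mul_le_mul_right ?_ h0
    nlinarith

lemma coercive_unique (hc : 0 < c) (hL : ∀ w, c * ‖w‖ ^ 2 ≤ (⟪L w, w⟫_ℂ).re) {w w' τ : H}
    (hw : w ∈ K) (hw' : w' ∈ K) (h : ∀ v ∈ K, ⟪L w + τ, v⟫_ℂ = 0)
    (h' : ∀ v ∈ K, ⟪L w' + τ, v⟫_ℂ = 0) : w = w' := by
  have := coercive_estimate (τ := 0) hL (K.sub_mem hw hw') fun v hv => by
    rw [map_sub, add_zero, show L w - L w' = (L w + τ) - (L w' + τ) by abel, inner_sub_left,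
      h v hv, h' v hv, sub_zero]
  rw [norm_zero] at this
  have h0 : ‖w - w'‖ = 0 := le_antisymm (by nlinarith [norm_nonneg (w - w')]) (norm_nonneg _)
  exact sub_eq_zero.mp (norm_eq_zero.mp h0)

/-- Lax-Milgram on `K`. A bounded linear operator is needed, and not just solutions, because its
powers form the Neumann series. -/
lemma exists_solutionOperator [CompleteSpace H] [K.HasOrthogonalProjection] (hc : 0 < c)
    (hL : ∀ w, c * ‖w‖ ^ 2 ≤ (⟪L w, w⟫_ℂ).re) :
    ∃ S : H →L[ℂ] H, ∀ τ, S τ ∈ K ∧ ∀ v ∈ K, ⟪L (S τ) + τ, v⟫_ℂ = 0 := by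
  set P : H →L[ℂ] H := K.starProjection
  have hPmem : ∀ x, P x ∈ K := fun x => K.starProjection_apply_mem x
  have hPfix : ∀ {x}, x ∈ K → P x = x := fun hx => K.starProjection_eq_self_iff.mpr hx
  have hPinner : ∀ x, ∀ v ∈ K, ⟪P x, v⟫_ℂ = ⟪x, v⟫_ℂ := fun x v hv => by
    rw [K.inner_starProjection_left_eq_right, hPfix hv]
  -- Filling the complement of `K` with the identity gives an operator coercive on all of `H`, with
  -- constant `min c 1`, so no restriction to the subspace is needed.
  set A : H →L[ℂ] H := P ∘L L ∘L P + (1 - P) with hA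
  have hAapp : ∀ x, A x = P (L (P x)) + (x - P x) := fun x => rfl
  have hcoer : ∀ x, ‖x‖ ^ 2 * min c 1 ≤ ‖⟪A x, x⟫_ℂ‖ := fun x => by
    have e1 : ⟪P (L (P x)), x⟫_ℂ = ⟪L (P x), P x⟫_ℂ := K.inner_starProjection_left_eq_right _ _
    have e2 : ⟪x - P x, P x⟫_ℂ = 0 := by
      rw [inner_sub_left, hPinner x _ (hPmem x), sub_self]
    have e3 : ⟪x - P x, x⟫_ℂ = (‖x - P x‖ ^ 2 : ℝ) := by
      conv_lhs => rw [show x = (x - P x) + P x by abel]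
      rw [show (x - P x) + P x - P ((x - P x) + P x) = x - P x by simp, inner_add_right, e2,
        add_zero, inner_self_eq_norm_sq_to_K]
      norm_cast
    have e4 : ‖x‖ ^ 2 = ‖x - P x‖ ^ 2 + ‖P x‖ ^ 2 := by
      have := norm_add_sq_eq_norm_sq_add_norm_sq_of_inner_eq_zero (x - P x) (P x) e2
      rw [sub_add_cancel] at this
      nlinarith
    have e5 : (⟪A x, x⟫_ℂ).re = (⟪L (P x), P x⟫_ℂ).re + ‖x - P x‖ ^ 2 := by
      rw [hAapp, inner_add_left, e1, e3, Complex.add_re, Complex.ofReal_re]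
    refine le_trans ?_ ((le_abs_self _).trans (Complex.abs_re_le_norm _))
    rw [e5, e4]
    have := hL (P x)
    nlinarith [min_le_left c 1, min_le_right c 1, sq_nonneg ‖x - P x‖, sq_nonneg ‖P x‖]
  have hunit : IsUnit A := ContinuousLinearMap.isUnit_of_forall_le_norm_inner_map A
    (c := ⟨min c 1, (lt_min hc one_pos).le⟩) (lt_min hc one_pos) hcoer
  obtain ⟨u, hu⟩ := hunit
  refine ⟨-((↑u⁻¹ : H →L[ℂ] H) ∘L P), fun τ => ?_⟩
  set z := (↑u⁻¹ : H →L[ℂ] H) (P τ) with hz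
  have hAz : A z = P τ := by
    rw [hz, ← hu]
    exact congrArg (fun f : H →L[ℂ] H => f (P τ)) u.mul_inv
  -- Projecting `A z = P τ` onto `K` removes the identity block, so that block vanishes on `z`.
  have hzK : P z = z := by
    have h1 := congrArg P hAz
    rw [hPfix (hPmem τ), hAapp, map_add, map_sub, hPfix (hPmem _), hPfix (hPmem _), sub_self,
      add_zero] at h1
    rw [hAapp, h1] at hAz
    have : z - P z = 0 := by simpa using hAz
    exact (sub_eq_zero.mp this).symm
  have hPz : P (L z) = P τ := by
    rw [hAapp, hzK, sub_self, add_zero] at hAz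
    exact hAz
  have hmem : z ∈ K := hzK ▸ hPmem z
  refine ⟨K.neg_mem hmem, fun v hv => ?_⟩
  change ⟪L (-z) + τ, v⟫_ℂ = 0
  rw [map_neg, inner_add_left, inner_neg_left, ← hPinner (L z) v hv, hPz, hPinner τ v hv,
    neg_add_cancel]

end Coercive

/-! ### Complex tensor fields -/

section TensorFields

open scoped InnerProductSpace

variable {d : ℕ} (b : Module.Basis (Fin d) ℝ (Space d))

/-- Complex scalar fields of class `L²(𝒱)`. -/
abbrev CField := Lp ℂ 2 (cellMeasure b)

/-- Complex second-order tensor fields of class `L²(𝒱)`. -/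
abbrev CTensorField := PiLp 2 (fun _ : Fin d × Fin d => CField b)

/-- The operator with given components. -/
def ofComponents {E : Type*} [NormedAddCommGroup E] [NormedSpace ℂ E]
    (f : Fin d × Fin d → (E →L[ℂ] CField b)) : E →L[ℂ] CTensorField b :=
  (PiLp.continuousLinearEquiv 2 ℂ _).symm.toContinuousLinearMap ∘L ContinuousLinearMap.pi f

@[simp]
lemma ofComponents_apply {E : Type*} [NormedAddCommGroup E] [NormedSpace ℂ E]
    (f : Fin d × Fin d → (E →L[ℂ] CField b)) (w : E) (p : Fin d × Fin d) :
    ofComponents b f w p = f p w := rfl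

/-- The trace of a tensor field. -/
def traceOp : CTensorField b →L[ℂ] CField b :=
  ∑ i, (PiLp.proj 2 (fun _ : Fin d × Fin d => CField b) (i, i) : CTensorField b →L[ℂ] CField b)

lemma traceOp_apply (w : CTensorField b) : traceOp b w = ∑ i, w (i, i) := by
  simp [traceOp]

/-- The spherical tensor field `g I`. -/
def sphericalOp : CField b →L[ℂ] CTensorField b :=
  ofComponents b fun p => if p.1 = p.2 then ContinuousLinearMap.id ℂ _ else 0

lemma sphericalOp_apply (g : CField b) (p : Fin d × Fin d) :
    sphericalOp b g p = if p.1 = p.2 then g else 0 := by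
  rw [sphericalOp, ofComponents_apply]
  split_ifs <;> rfl

/-- The spherical projector on tensor fields. -/
def sphOp : CTensorField b →L[ℂ] CTensorField b :=
  ((d : ℂ)⁻¹) • (sphericalOp b ∘L traceOp b)

lemma sphOp_apply (w : CTensorField b) (p : Fin d × Fin d) :
    sphOp b w p = if p.1 = p.2 then (d : ℂ)⁻¹ • traceOp b w else 0 := by
  have : sphOp b w p = (d : ℂ)⁻¹ • sphericalOp b (traceOp b w) p := rfl
  rw [this, sphericalOp_apply]
  split_ifs
  · rfl
  · exact smul_zero _

/-- Multiplication by a bounded real function. -/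
def mulOp {a : Space d → ℝ} (ha : MemLp a ⊤ (cellMeasure b)) : CField b →L[ℂ] CField b :=
  (ContinuousLinearMap.mul ℂ ℂ).holderL (cellMeasure b) ⊤ 2 2
    ((ha.ofReal (K := ℂ)).toLp fun x => (a x : ℂ))

lemma coeFn_mulOp {a : Space d → ℝ} (ha : MemLp a ⊤ (cellMeasure b)) (f : CField b) :
    mulOp b ha f =ᵐ[cellMeasure b] fun x => (a x : ℂ) * f x := by
  refine ((ContinuousLinearMap.mul ℂ ℂ).coeFn_holder (r := 2) _ f).trans ?_
  filter_upwards [(ha.ofReal (K := ℂ)).coeFn_toLp] with x hx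
  rw [ContinuousLinearMap.mul_apply']
  exact congrArg (· * f x) hx

lemma norm_mulOp_apply_le {a : Space d → ℝ} (ha : MemLp a ⊤ (cellMeasure b)) {C : ℝ}
    (hb : ∀ᵐ x ∂(cellMeasure b), |a x| ≤ C) (f : CField b) :
    ‖mulOp b ha f‖ ≤ C * ‖f‖ := by
  refine Lp.norm_le_mul_norm_of_ae_le_mul ?_
  filter_upwards [coeFn_mulOp b ha f, hb] with x hx hbx
  rw [hx, norm_mul, Complex.norm_real, Real.norm_eq_abs]
  gcongr

/-- Multiplication of a tensor field by a bounded real function. -/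
def mulTensorOp {a : Space d → ℝ} (ha : MemLp a ⊤ (cellMeasure b)) :
    CTensorField b →L[ℂ] CTensorField b :=
  ofComponents b fun p => mulOp b ha ∘L PiLp.proj 2 (fun _ : Fin d × Fin d => CField b) p

lemma norm_mulTensorOp_le {a : Space d → ℝ} (ha : MemLp a ⊤ (cellMeasure b)) {C : ℝ}
    (hC : 0 ≤ C) (hb : ∀ᵐ x ∂(cellMeasure b), |a x| ≤ C) : ‖mulTensorOp b ha‖ ≤ C := by
  refine ContinuousLinearMap.opNorm_le_bound _ hC fun w => ?_
  refine le_of_sq_le_sq ?_ (by positivity)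
  rw [mul_pow, PiLp.norm_sq_eq_of_L2, PiLp.norm_sq_eq_of_L2, Finset.mul_sum]
  refine Finset.sum_le_sum fun p _ => ?_
  rw [← mul_pow]
  exact pow_le_pow_left₀ (norm_nonneg _) (norm_mulOp_apply_le b ha hb (w p)) 2

/-- The elasticity operator with constant moduli. -/
def constStressOp (κ μ : ℝ) : CTensorField b →L[ℂ] CTensorField b :=
  ((d : ℂ) * κ) • sphOp b + (2 * μ : ℂ) • (1 - sphOp b)

/-- The elasticity operator with bounded moduli. -/
def stressOp {κ μ : Space d → ℝ} (hκ : MemLp κ ⊤ (cellMeasure b))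
    (hμ : MemLp μ ⊤ (cellMeasure b)) : CTensorField b →L[ℂ] CTensorField b :=
  mulTensorOp b hκ ∘L ((d : ℂ) • sphOp b) + mulTensorOp b hμ ∘L ((2 : ℂ) • (1 - sphOp b))

lemma exists_norm_stressOp_le : ∃ A : ℝ, 0 < A ∧ ∀ {κ μ : Space d → ℝ}
    (hκ : MemLp κ ⊤ (cellMeasure b)) (hμ : MemLp μ ⊤ (cellMeasure b)) {C : ℝ}, 0 ≤ C →
    (∀ᵐ x ∂(cellMeasure b), |κ x| ≤ C) → (∀ᵐ x ∂(cellMeasure b), |μ x| ≤ C) →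
    ‖stressOp b hκ hμ‖ ≤ A * C := by
  -- The summand `1` only makes the constant positive, so that it can be divided by later.
  refine ⟨‖(d : ℂ) • sphOp b‖ + ‖(2 : ℂ) • (1 - sphOp b)‖ + 1, by positivity, ?_⟩
  intro κ μ hκ hμ C hC h1 h2
  refine (norm_add_le _ _).trans ?_
  have e1 := ((mulTensorOp b hκ).opNorm_comp_le ((d : ℂ) • sphOp b)).trans
    (mul_le_mul_of_nonneg_right (norm_mulTensorOp_le b hκ hC h1) (norm_nonneg _))
  have e2 := ((mulTensorOp b hμ).opNorm_comp_le ((2 : ℂ) • (1 - sphOp b))).trans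
    (mul_le_mul_of_nonneg_right (norm_mulTensorOp_le b hμ hC h2) (norm_nonneg _))
  linarith

lemma inner_sphOp_self (w : CTensorField b) :
    ⟪sphOp b w, w⟫_ℂ = (‖sphOp b w‖ ^ 2 : ℝ) := by
  rcases Nat.eq_zero_or_pos d with rfl | hd
  · simp [Subsingleton.elim w 0]
  have hd' : (d : ℝ) ≠ 0 := by positivity
  rw [PiLp.norm_sq_eq_of_L2, PiLp.inner_apply, Fintype.sum_prod_type, Fintype.sum_prod_type]
  simp only [sphOp_apply]
  have e1 : ∀ i : Fin d, ∑ j : Fin d,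
      ⟪(if i = j then (d : ℂ)⁻¹ • traceOp b w else 0 : CField b), w (i, j)⟫_ℂ
        = (d : ℂ)⁻¹ * ⟪traceOp b w, w (i, i)⟫_ℂ := fun i => by
    rw [Finset.sum_eq_single i]
    · rw [if_pos rfl, inner_smul_left]
      simp
    · intro j _ hj
      rw [if_neg (Ne.symm hj), inner_zero_left]
    · simp
  have e2 : ∀ i : Fin d, ∑ j : Fin d,
      ‖(if i = j then (d : ℂ)⁻¹ • traceOp b w else 0 : CField b)‖ ^ 2
        = (d : ℝ)⁻¹ ^ 2 * ‖traceOp b w‖ ^ 2 := fun i => by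
    rw [Finset.sum_eq_single i]
    · rw [if_pos rfl, norm_smul, mul_pow]
      simp
    · intro j _ hj
      rw [if_neg (Ne.symm hj)]; simp
    · simp
  simp only [e1, e2]
  rw [← Finset.mul_sum, ← inner_sum, ← traceOp_apply, inner_self_eq_norm_sq_to_K]
  simp only [Finset.sum_const, Finset.card_univ, Fintype.card_fin, nsmul_eq_mul]
  have : (d : ℂ) ≠ 0 := by exact_mod_cast hd'
  push_cast
  field_simp
  simp

lemma norm_sphOp_apply_le (w : CTensorField b) : ‖sphOp b w‖ ≤ ‖w‖ := by
  have h := norm_inner_le_norm (𝕜 := ℂ) (sphOp b w) w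
  rw [inner_sphOp_self, Complex.norm_real, Real.norm_eq_abs, abs_of_nonneg (by positivity)] at h
  rcases (norm_nonneg (sphOp b w)).eq_or_lt with h0 | h0
  · rw [← h0]; positivity
  · exact le_of_mul_le_mul_left (by rw [← sq]; exact h) h0

/-- The spherical and deviatoric parts are orthogonal, so the form is a sum of their squared norms
with weights `d κ` and `2 μ`. -/
lemma constStressOp_coercive {κ μ : ℝ} (w : CTensorField b) :
    min (d * κ) (2 * μ) * ‖w‖ ^ 2 ≤ (⟪constStressOp b κ μ w, w⟫_ℂ).re := by
  have e : ⟪constStressOp b κ μ w, w⟫_ℂ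
      = ((d * κ * ‖sphOp b w‖ ^ 2 + 2 * μ * (‖w‖ ^ 2 - ‖sphOp b w‖ ^ 2) : ℝ) : ℂ) := by
    have : constStressOp b κ μ w
      = ((d : ℂ) * κ) • sphOp b w + (2 * μ : ℂ) • (w - sphOp b w) := rfl
    rw [this, inner_add_left, inner_smul_left, inner_smul_left, inner_sub_left, inner_sphOp_self,
      inner_self_eq_norm_sq_to_K]
    simp [Complex.conj_ofNat]
  rw [e, Complex.ofReal_re]
  have h := pow_le_pow_left₀ (norm_nonneg _) (norm_sphOp_apply_le b w) 2
  nlinarith [min_le_left (d * κ) (2 * μ), min_le_right (d * κ) (2 * μ), sq_nonneg ‖sphOp b w‖]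

/-! ### Compatible fields -/

/-- The `j`-th coordinate of the dual lattice vector of index `n`. -/
def freq (n : Fin d → ℤ) (j : Fin d) : ℝ :=
  ∑ i, (n i : ℝ) * b.repr (EuclideanSpace.single j 1) i

lemma sum_freq_mul (n : Fin d → ℤ) (x : Space d) :
    ∑ j, freq b n j * x j = ∑ i, (n i : ℝ) * b.repr x i := by
  have hx : x = ∑ j, x j • EuclideanSpace.single j (1 : ℝ) := by
    conv_lhs => rw [← (EuclideanSpace.basisFun (Fin d) ℝ).sum_repr x]
    simp
  have hr : ∀ i, b.repr x i = ∑ j, x j * b.repr (EuclideanSpace.single j 1) i := fun i => by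
    conv_lhs => rw [hx]
    simp only [map_sum, map_smul, Finsupp.coe_finsetSum, Finset.sum_apply, Finsupp.smul_apply,
      smul_eq_mul]
  simp only [freq, hr, Finset.sum_mul, Finset.mul_sum]
  rw [Finset.sum_comm]
  refine Finset.sum_congr rfl fun i _ => Finset.sum_congr rfl fun j _ => by ring

/-- A dual vector which vanishes is zero on each `b i`, where it takes the value `n i`. -/
lemma sum_freq_sq_pos {n : Fin d → ℤ} (hn : n ≠ 0) : 0 < ∑ j, freq b n j ^ 2 := by
  refine lt_of_le_of_ne (Finset.sum_nonneg fun j _ => sq_nonneg _) fun h => hn ?_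
  have h0 : ∀ j, freq b n j = 0 := fun j => by
    have := (Finset.sum_eq_zero_iff_of_nonneg fun j _ => sq_nonneg (freq b n j)).mp h.symm j
      (Finset.mem_univ j)
    exact pow_eq_zero_iff two_ne_zero |>.mp this
  funext i
  have h1 := sum_freq_mul b n (b i)
  simp only [h0, zero_mul, Finset.sum_const_zero] at h1
  rw [Finset.sum_eq_single i] at h1
  · simpa using h1.symm
  · intro j _ hj
    simp [Ne.symm hj]
  · simp

/-- The Fourier symbol of the symmetrized gradient. -/
def symGradSymbol (n : Fin d → ℤ) : (Fin d → ℂ) →ₗ[ℂ] (Fin d × Fin d → ℂ) :=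
  LinearMap.pi fun p =>
    (freq b n p.2 : ℂ) • LinearMap.proj p.1 + (freq b n p.1 : ℂ) • LinearMap.proj p.2

/-- The Fourier coefficient of index `n` of a tensor field. -/
def tensorCoeff (n : Fin d → ℤ) : CTensorField b →L[ℂ] (Fin d × Fin d → ℂ) :=
  ContinuousLinearMap.pi fun p =>
    innerSL ℂ (fourierBasis b n) ∘L PiLp.proj 2 (fun _ : Fin d × Fin d => CField b) p

/-- The symmetrized gradients of periodic displacements. -/
def compatibleFields : Submodule ℂ (CTensorField b) :=
  ⨅ n, (LinearMap.range (symGradSymbol b n)).comap (tensorCoeff b n).toLinearMap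

/-- The factor `πi` of differentiation is absorbed in `v`. At `n = 0` the condition says that `w`
has zero mean. -/
lemma mem_compatibleFields {w : CTensorField b} : w ∈ compatibleFields b ↔
    ∀ n, ∃ v : Fin d → ℂ, ∀ i j,
      ⟪fourierBasis b n, w (i, j)⟫_ℂ = freq b n j * v i + freq b n i * v j := by
  simp only [compatibleFields, Submodule.mem_iInf, Submodule.mem_comap, LinearMap.mem_range]
  refine forall_congr' fun n => exists_congr fun v => ?_
  rw [funext_iff, Prod.forall]
  exact forall_congr' fun i => forall_congr' fun j => eq_comm

/-- Each frequency imposes membership in a finite-dimensional, hence closed, subspace. Completeness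
provides the orthogonal projection. -/
instance : CompleteSpace (compatibleFields b) := by
  refine IsClosed.completeSpace_coe (hs := ?_)
  simp only [compatibleFields, Submodule.coe_iInf]
  exact isClosed_iInter fun n =>
    (Submodule.closed_of_finiteDimensional (LinearMap.range (symGradSymbol b n))).preimage
      (tensorCoeff b n).continuous

/-- A symmetric stress of zero divergence is orthogonal to the compatible fields. -/
lemma inner_eq_zero_of_divergence_eq_zero {σ w : CTensorField b}
    (hsymm : ∀ i j, σ (i, j) = σ (j, i))
    (hdiv : ∀ n i, ∑ j, freq b n j * ⟪fourierBasis b n, σ (i, j)⟫_ℂ = 0)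
    (hw : w ∈ compatibleFields b) : ⟪σ, w⟫_ℂ = 0 := by
  rw [PiLp.inner_apply]
  have h := hasSum_sum (s := Finset.univ) fun (p : Fin d × Fin d) _ =>
    (fourierBasis b).hasSum_inner_mul_inner (σ p) (w p)
  refine h.unique ?_
  convert hasSum_zero with n
  obtain ⟨v, hv⟩ := (mem_compatibleFields b).mp hw n
  have hdiv' : ∀ i, ∑ j, (freq b n j : ℂ) * ⟪σ (i, j), fourierBasis b n⟫_ℂ = 0 := fun i => by
    have := congrArg (starRingEnd ℂ) (hdiv n i)
    simpa [map_sum, inner_conj_symm] using this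
  rw [Fintype.sum_prod_type]
  simp only [hv, mul_add, Finset.sum_add_distrib]
  have e1 : ∑ i, ∑ j, ⟪σ (i, j), fourierBasis b n⟫_ℂ * (freq b n j * v i) = 0 :=
    Finset.sum_eq_zero fun i _ => by
      rw [← zero_mul (v i), ← hdiv' i, Finset.sum_mul]
      exact Finset.sum_congr rfl fun j _ => by ring
  -- The symmetry of `σ` turns this sum into the previous one.
  have e2 : ∑ i, ∑ j, ⟪σ (i, j), fourierBasis b n⟫_ℂ * (freq b n i * v j) = 0 := by
    rw [Finset.sum_comm]
    simp_rw [fun i j => hsymm i j]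
    simpa only [hsymm] using e1
  rw [e1, e2, add_zero]

/-- The tensor field `ξ ⊗ ξ e^{2πi ξ·x}`. -/
def longitudinalMode (n : Fin d → ℤ) : CTensorField b :=
  WithLp.toLp 2 fun p => ((freq b n p.1 * freq b n p.2 : ℝ) : ℂ) • fourierBasis b n

lemma longitudinalMode_mem (n : Fin d → ℤ) : longitudinalMode b n ∈ compatibleFields b := by
  rw [mem_compatibleFields]
  intro m
  by_cases h : m = n
  · subst h
    refine ⟨fun i => freq b m i / 2, fun i j => ?_⟩
    simp only [longitudinalMode]
    rw [inner_smul_right, inner_self_eq_norm_sq_to_K, (fourierBasis b).orthonormal.1 m]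
    push_cast
    ring
  · refine ⟨0, fun i j => ?_⟩
    simp only [longitudinalMode]
    rw [inner_smul_right, (fourierBasis b).orthonormal.2 h]
    simp

/-- This is the double divergence of the stress, read off by testing with one longitudinal mode. -/
lemma sum_freq_freq_coeff {σ : CTensorField b} (n : Fin d → ℤ)
    (h : ∀ v ∈ compatibleFields b, ⟪σ, v⟫_ℂ = 0) :
    ∑ i, ∑ j, (freq b n i * freq b n j : ℂ) * ⟪fourierBasis b n, σ (i, j)⟫_ℂ = 0 := by
  have := congrArg (starRingEnd ℂ) (h _ (longitudinalMode_mem b n))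
  rw [PiLp.inner_apply, Fintype.sum_prod_type] at this
  simp only [longitudinalMode, inner_smul_right, map_sum, map_mul, inner_conj_symm, map_zero,
    Complex.conj_ofReal, Complex.ofReal_mul] at this
  exact this

/-- For a symmetrized gradient, the double divergence is the Laplacian of the trace; this is why the
trace decouples from the other components. -/
lemma sum_freq_freq_coeff_compatible {w : CTensorField b} (hw : w ∈ compatibleFields b)
    (n : Fin d → ℤ) :
    ∑ i, ∑ j, (freq b n i * freq b n j : ℂ) * ⟪fourierBasis b n, w (i, j)⟫_ℂ
      = (∑ i, (freq b n i : ℂ) ^ 2) * ⟪fourierBasis b n, traceOp b w⟫_ℂ := by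
  obtain ⟨v, hv⟩ := (mem_compatibleFields b).mp hw n
  rw [traceOp_apply, inner_sum]
  simp only [hv]
  have e1 : ∀ i j, (freq b n i * freq b n j : ℂ) * (freq b n j * v i + freq b n i * v j)
      = (freq b n i * v i) * (freq b n j) ^ 2 + (freq b n i) ^ 2 * (freq b n j * v j) :=
    fun i j => by ring
  simp only [e1, Finset.sum_add_distrib, ← Finset.mul_sum, ← Finset.sum_mul]
  ring

lemma sum_freq_freq_coeff_spherical (g : CField b) (n : Fin d → ℤ) :
    ∑ i, ∑ j, (freq b n i * freq b n j : ℂ) * ⟪fourierBasis b n, sphericalOp b g (i, j)⟫_ℂ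
      = (∑ i, (freq b n i : ℂ) ^ 2) * ⟪fourierBasis b n, g⟫_ℂ := by
  rw [Finset.sum_mul]
  refine Finset.sum_congr rfl fun i _ => ?_
  rw [Finset.sum_eq_single i]
  · rw [sphericalOp_apply, if_pos rfl]; ring
  · intro j _ hj
    rw [sphericalOp_apply, if_neg (Ne.symm hj), inner_zero_right, mul_zero]
  · simp

lemma constStressOp_eq (κ μ : ℝ) (w : CTensorField b) : constStressOp b κ μ w
    = (2 * μ : ℂ) • w + sphericalOp b (((κ : ℂ) * d - 2 * μ) • (d : ℂ)⁻¹ • traceOp b w) := by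
  have : constStressOp b κ μ w
      = ((d : ℂ) * κ) • sphOp b w + (2 * μ : ℂ) • (w - sphOp b w) := rfl
  have h2 : sphOp b w = (d : ℂ)⁻¹ • sphericalOp b (traceOp b w) := rfl
  rw [this, h2, map_smul, map_smul]
  module

/-- The trace of the strain response to a spherical eigenstress. -/
lemma norm_traceOp_add_le (hd : d ≠ 0) {κ₀ μ₀ : ℝ} {w τ : CTensorField b} {g : CField b}
    (hw : w ∈ compatibleFields b) (hg : ⟪fourierBasis b 0, g⟫_ℂ = 0)
    (h : ∀ v ∈ compatibleFields b, ⟪constStressOp b κ₀ μ₀ w + (sphericalOp b g + τ), v⟫_ℂ = 0) :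
    ‖((lamJInv d κ₀ μ₀ / d : ℝ) : ℂ) • traceOp b w + g‖ ≤ ‖τ‖ := by
  set F := ((lamJInv d κ₀ μ₀ / d : ℝ) : ℂ) • traceOp b w + g with hF
  have hdc : (d : ℂ) ≠ 0 := by exact_mod_cast hd
  have hFcoeff : ∀ n, ⟪fourierBasis b n, F⟫_ℂ = ((lamJInv d κ₀ μ₀ / d : ℝ) : ℂ) *
      ⟪fourierBasis b n, traceOp b w⟫_ℂ + ⟪fourierBasis b n, g⟫_ℂ := fun n => by
    rw [hF, inner_add_right, inner_smul_right]
  -- The coefficient of the trace is `2 μ₀ + (d κ₀ - 2 μ₀) / d = λ_J⁻¹ / d`.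
  have hkey : ∀ n, (∑ i, (freq b n i : ℂ) ^ 2) * ⟪fourierBasis b n, F⟫_ℂ
      = -∑ i, ∑ j, (freq b n i * freq b n j : ℂ) * ⟪fourierBasis b n, τ (i, j)⟫_ℂ := fun n => by
    have h1 := sum_freq_freq_coeff b n h
    rw [constStressOp_eq] at h1
    have e : ∀ p, ((2 * μ₀ : ℂ) • w + sphericalOp b (((κ₀ : ℂ) * d - 2 * μ₀) • (d : ℂ)⁻¹ •
        traceOp b w) + (sphericalOp b g + τ)) p = (2 * μ₀ : ℂ) • w p + sphericalOp b
        (((κ₀ : ℂ) * d - 2 * μ₀) • (d : ℂ)⁻¹ • traceOp b w) p + (sphericalOp b g p + τ p) :=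
      fun p => rfl
    simp only [e, inner_add_right, mul_add, Finset.sum_add_distrib] at h1
    rw [sum_freq_freq_coeff_spherical, sum_freq_freq_coeff_spherical] at h1
    have e2 : ∑ i, ∑ j, (freq b n i * freq b n j : ℂ) *
        ⟪fourierBasis b n, (2 * μ₀ : ℂ) • w (i, j)⟫_ℂ
        = (2 * μ₀ : ℂ) * ((∑ i, (freq b n i : ℂ) ^ 2) * ⟪fourierBasis b n, traceOp b w⟫_ℂ) := by
      rw [← sum_freq_freq_coeff_compatible b hw n]
      simp only [inner_smul_right, Finset.mul_sum]
      exact Finset.sum_congr rfl fun i _ => Finset.sum_congr rfl fun j _ => by ring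
    rw [e2, inner_smul_right, inner_smul_right] at h1
    rw [hFcoeff, eq_neg_iff_add_eq_zero, ← h1, lamJInv]
    push_cast
    field_simp
    ring
  have hcoeff : ∀ n, ‖⟪fourierBasis b n, F⟫_ℂ‖ ^ 2
      ≤ ∑ p : Fin d × Fin d, ‖⟪fourierBasis b n, τ p⟫_ℂ‖ ^ 2 := fun n => by
    -- At zero frequency `hkey` is void; there `tr w` has zero mean by compatibility and `g` by
    -- `hg`.
    by_cases hn : n = 0
    · have h0 : ⟪fourierBasis b n, F⟫_ℂ = 0 := by
        subst hn
        rw [hFcoeff, hg, traceOp_apply, inner_sum]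
        obtain ⟨v, hv⟩ := (mem_compatibleFields b).mp hw 0
        simp [hv, freq]
      rw [h0]
      simpa using Finset.sum_nonneg fun p _ => sq_nonneg _
    · have hpos := sum_freq_sq_pos b hn
      set s := ∑ j, freq b n j ^ 2 with hs
      have h1 : s * ‖⟪fourierBasis b n, F⟫_ℂ‖
          ≤ ∑ p : Fin d × Fin d, |freq b n p.1 * freq b n p.2| * ‖⟪fourierBasis b n, τ p⟫_ℂ‖ := by
        have h2 := congrArg norm (hkey n)
        rw [norm_mul, norm_neg, show (∑ i, (freq b n i : ℂ) ^ 2) = ((s : ℝ) : ℂ) by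
          rw [hs]; push_cast; rfl, Complex.norm_real, Real.norm_eq_abs, abs_of_pos hpos] at h2
        rw [h2, ← Fintype.sum_prod_type' fun i j => (freq b n i * freq b n j : ℂ) *
          ⟪fourierBasis b n, τ (i, j)⟫_ℂ]
        refine (norm_sum_le _ _).trans (Finset.sum_le_sum fun p _ => ?_)
        rw [norm_mul, ← Complex.ofReal_mul, Complex.norm_real, Real.norm_eq_abs]
      have h3 := Finset.sum_mul_sq_le_sq_mul_sq Finset.univ
        (fun p : Fin d × Fin d => |freq b n p.1 * freq b n p.2|)
        (fun p => ‖⟪fourierBasis b n, τ p⟫_ℂ‖)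
      -- The norm of `ξ ⊗ ξ` is `|ξ|²`, which cancels the left factor and leaves the constant one.
      have h4 : ∑ p : Fin d × Fin d, |freq b n p.1 * freq b n p.2| ^ 2 = s ^ 2 := by
        rw [Fintype.sum_prod_type, hs, sq (∑ j, freq b n j ^ 2), Finset.sum_mul_sum]
        simp only [sq_abs, mul_pow]
      rw [h4] at h3
      have h5 := (pow_le_pow_left₀ (by positivity) h1 2).trans h3
      rw [mul_pow] at h5
      exact le_of_mul_le_mul_left h5 (by positivity)
  have hnorm : ∀ f : CField b, HasSum (fun n => ‖⟪fourierBasis b n, f⟫_ℂ‖ ^ 2) (‖f‖ ^ 2) :=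
    fun f => by
      have h1 := (fourierBasis b).hasSum_inner_mul_inner f f
      rw [inner_self_eq_norm_sq_to_K] at h1
      have h2 := ((Complex.hasSum_iff _ _).mp h1).1
      have e1 : ∀ n, (⟪f, fourierBasis b n⟫_ℂ * ⟪fourierBasis b n, f⟫_ℂ).re
          = ‖⟪fourierBasis b n, f⟫_ℂ‖ ^ 2 := fun n => by
        rw [← inner_conj_symm f, Complex.conj_mul', ← Complex.ofReal_pow, Complex.ofReal_re]
      simp only [e1] at h2
      convert h2 using 1
      exact (Complex.ofReal_re (‖f‖ ^ 2)).symm.trans (by push_cast; rfl)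
  refine le_of_sq_le_sq ?_ (norm_nonneg _)
  rw [PiLp.norm_sq_eq_of_L2]
  exact hasSum_le hcoeff (hnorm F) (hasSum_sum fun p _ => hnorm (τ p))

end TensorFields

/-! ### Trigonometric test functions -/

section TestFunctions

open scoped InnerProductSpace

variable {d : ℕ} (b : Module.Basis (Fin d) ℝ (Space d))

/-- The phase as a continuous linear form. -/
def phaseL (n : Fin d → ℤ) : Space d →L[ℝ] ℝ :=
  LinearMap.toContinuousLinearMap ((2 * Real.pi) • ∑ i, (n i : ℝ) • b.coord i)

lemma phaseL_apply (n : Fin d → ℤ) (x : Space d) : phaseL b n x = phase b n x := by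
  simp [phaseL, phase]

lemma phaseL_single (n : Fin d → ℤ) (j : Fin d) :
    phaseL b n (EuclideanSpace.single j 1) = 2 * Real.pi * freq b n j := by
  rw [phaseL_apply, phase, freq]

lemma phase_add_basis (n : Fin d → ℤ) (i : Fin d) (x : Space d) :
    phase b n (x + b i) = phase b n x + n i * (2 * Real.pi) := by
  have : phase b n (b i) = n i * (2 * Real.pi) := by
    rw [phase, Finset.sum_eq_single i]
    · simp; ring
    · intro j _ hj
      simp [Ne.symm hj]
    · simp
  rw [← phaseL_apply, map_add, phaseL_apply, phaseL_apply, this]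

lemma contDiff_phase (n : Fin d → ℤ) : ContDiff ℝ ∞ (phase b n) := by
  have : phase b n = phaseL b n := funext fun x => (phaseL_apply b n x).symm
  rw [this]
  exact (phaseL b n).contDiff

lemma hasFDerivAt_phase (n : Fin d → ℤ) (x : Space d) :
    HasFDerivAt (phase b n) (phaseL b n) x := by
  have : phase b n = phaseL b n := funext fun x => (phaseL_apply b n x).symm
  rw [this]
  exact (phaseL b n).hasFDerivAt

lemma isTest_cos (n : Fin d → ℤ) : IsTest b fun x => Real.cos (phase b n x) :=
  ⟨fun i x => by simp only [phase_add_basis, Real.cos_add_int_mul_two_pi],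
    Real.contDiff_cos.comp (contDiff_phase b n)⟩

lemma isTest_sin (n : Fin d → ℤ) : IsTest b fun x => Real.sin (phase b n x) :=
  ⟨fun i x => by simp only [phase_add_basis, Real.sin_add_int_mul_two_pi],
    Real.contDiff_sin.comp (contDiff_phase b n)⟩

lemma partialDeriv_cos (n : Fin d → ℤ) (j : Fin d) (x : Space d) :
    partialDeriv j (fun x => Real.cos (phase b n x)) x
      = -(2 * Real.pi * freq b n j) * Real.sin (phase b n x) := by
  rw [partialDeriv, (hasFDerivAt_phase b n x).cos.fderiv, _root_.smul_apply,
    phaseL_single, smul_eq_mul]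
  ring

lemma partialDeriv_sin (n : Fin d → ℤ) (j : Fin d) (x : Space d) :
    partialDeriv j (fun x => Real.sin (phase b n x)) x
      = 2 * Real.pi * freq b n j * Real.cos (phase b n x) := by
  rw [partialDeriv, (hasFDerivAt_phase b n x).sin.fderiv, _root_.smul_apply,
    phaseL_single, smul_eq_mul]
  ring

/-! ### Real fields as elements of the complex `L²` space -/

/-- A complex field which agrees almost everywhere with a real function. -/
def Represents (F : CField b) (f : Space d → ℝ) : Prop :=
  F =ᵐ[cellMeasure b] fun x => (f x : ℂ)

variable {b}

lemma exists_represents {f : Space d → ℝ} (hf : MemLp f 2 (cellMeasure b)) :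
    ∃ F, Represents b F f :=
  ⟨(hf.ofReal (K := ℂ)).toLp _, (hf.ofReal (K := ℂ)).coeFn_toLp⟩

lemma Represents.memLp {F : CField b} {f : Space d → ℝ} (h : Represents b F f) :
    MemLp f 2 (cellMeasure b) := by
  have h1 : MemLp (fun x => RCLike.re (F x)) 2 (cellMeasure b) := (Lp.memLp F).re
  refine h1.ae_eq ?_
  filter_upwards [h] with x hx
  rw [hx]
  exact Complex.ofReal_re _

lemma Represents.integrable {F : CField b} {f : Space d → ℝ} (h : Represents b F f) :
    Integrable f (cellMeasure b) := h.memLp.integrable (by norm_num)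

lemma Represents.eLpNorm_eq {F : CField b} {f : Space d → ℝ} (h : Represents b F f) :
    eLpNorm f 2 (cellMeasure b) = ENNReal.ofReal ‖F‖ := by
  rw [ofReal_norm, Lp.enorm_def]
  refine eLpNorm_congr_norm_ae ?_
  filter_upwards [h] with x hx
  rw [hx, Complex.norm_real]

lemma Represents.congr {F : CField b} {f g : Space d → ℝ} (h : Represents b F f)
    (hfg : f =ᵐ[cellMeasure b] g) : Represents b F g := by
  filter_upwards [h, hfg] with x hx hx'
  rw [hx, hx']

lemma Represents.eq {F G : CField b} {f : Space d → ℝ} (hF : Represents b F f)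
    (hG : Represents b G f) : F = G :=
  Lp.ext (hF.trans hG.symm)

lemma Represents.add {F G : CField b} {f g : Space d → ℝ} (hF : Represents b F f)
    (hG : Represents b G g) : Represents b (F + G) (fun x => f x + g x) := by
  filter_upwards [Lp.coeFn_add F G, hF, hG] with x h1 h2 h3
  rw [h1, Pi.add_apply, h2, h3]
  push_cast; rfl

lemma Represents.sub {F G : CField b} {f g : Space d → ℝ} (hF : Represents b F f)
    (hG : Represents b G g) : Represents b (F - G) (fun x => f x - g x) := by
  filter_upwards [Lp.coeFn_sub F G, hF, hG] with x h1 h2 h3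
  rw [h1, Pi.sub_apply, h2, h3]
  push_cast; rfl

lemma Represents.smul {F : CField b} {f : Space d → ℝ} (hF : Represents b F f) (c : ℝ) :
    Represents b ((c : ℂ) • F) (fun x => c * f x) := by
  filter_upwards [Lp.coeFn_smul (c : ℂ) F, hF] with x h1 h2
  rw [h1, Pi.smul_apply, h2, smul_eq_mul]
  push_cast; rfl

lemma represents_zero : Represents b 0 fun _ => 0 := by
  filter_upwards [Lp.coeFn_zero ℂ 2 (cellMeasure b)] with x hx
  rw [hx]
  simp

lemma Represents.sum {ι : Type*} (s : Finset ι) {F : ι → CField b} {f : ι → Space d → ℝ}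
    (h : ∀ i, Represents b (F i) (f i)) : Represents b (∑ i ∈ s, F i) (fun x => ∑ i ∈ s, f i x) := by
  classical
  induction s using Finset.induction_on with
  | empty => simpa using represents_zero
  | insert i s hi ih =>
    simp only [Finset.sum_insert hi]
    exact (h i).add ih

lemma Represents.mulOp {F : CField b} {f a : Space d → ℝ} (hF : Represents b F f)
    (ha : MemLp a ⊤ (cellMeasure b)) : Represents b (mulOp b ha F) (fun x => a x * f x) := by
  filter_upwards [coeFn_mulOp b ha F, hF] with x h1 h2
  rw [h1, h2]
  push_cast; rfl

lemma represents_fourierBasis_zero : Represents b (fourierBasis b 0) fun _ => 1 := by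
  rw [fourierBasis_apply]
  filter_upwards [(memLp_exp_phase b 0).coeFn_toLp] with x hx
  rw [hx]
  simp [phase]

lemma Represents.integrable_mul_bounded {F : CField b} {f φ : Space d → ℝ}
    (h : Represents b F f) (hφ : Continuous φ) {C : ℝ} (hC : ∀ x, |φ x| ≤ C) :
    Integrable (fun x => f x * φ x) (cellMeasure b) :=
  h.integrable.mul_bdd hφ.aestronglyMeasurable (Eventually.of_forall hC)

lemma Represents.integrable_mul_cos {F : CField b} {f : Space d → ℝ} (h : Represents b F f)
    (n : Fin d → ℤ) : Integrable (fun x => f x * Real.cos (phase b n x)) (cellMeasure b) :=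
  h.integrable_mul_bounded (Real.continuous_cos.comp (continuous_phase b n))
    fun _ => Real.abs_cos_le_one _

lemma Represents.integrable_mul_sin {F : CField b} {f : Space d → ℝ} (h : Represents b F f)
    (n : Fin d → ℤ) : Integrable (fun x => f x * Real.sin (phase b n x)) (cellMeasure b) :=
  h.integrable_mul_bounded (Real.continuous_sin.comp (continuous_phase b n))
    fun _ => Real.abs_sin_le_one _

lemma Represents.inner_fourierBasis {F : CField b} {f : Space d → ℝ} (h : Represents b F f)
    (n : Fin d → ℤ) : ⟪fourierBasis b n, F⟫_ℂ
      = (∫ x, f x * Real.cos (phase b n x) ∂(cellMeasure b) : ℝ)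
        - (∫ x, f x * Real.sin (phase b n x) ∂(cellMeasure b) : ℝ) * Complex.I := by
  rw [L2.inner_def, ← integral_complex_ofReal, ← integral_complex_ofReal, ← integral_mul_const,
    ← integral_sub (h.integrable_mul_cos n).ofReal ((h.integrable_mul_sin n).ofReal.mul_const _)]
  refine integral_congr_ae ?_
  rw [fourierBasis_apply]
  filter_upwards [h, (memLp_exp_phase b n).coeFn_toLp] with x h1 h2
  rw [h1, h2, RCLike.inner_apply, ← Complex.exp_conj]
  simp only [map_mul, Complex.conj_ofReal, Complex.conj_I, mul_neg]
  rw [← neg_mul, Complex.exp_mul_I, Complex.cos_neg, Complex.sin_neg]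
  push_cast
  ring

/-- Test functions are real, so the exponential is tested through its cosine and sine separately. -/
lemma inner_fourierBasis_of_hasWeakPartial {U G : CField b} {u g : Space d → ℝ} {j : Fin d}
    (hU : Represents b U u) (hG : Represents b G g) (h : HasWeakPartial b j u g) (n : Fin d → ℤ) :
    ⟪fourierBasis b n, G⟫_ℂ
      = freq b n j * (2 * Real.pi * Complex.I * ⟪fourierBasis b n, U⟫_ℂ) := by
  have h1 := h _ (isTest_cos b n)
  have h2 := h _ (isTest_sin b n)
  simp only [partialDeriv_cos, partialDeriv_sin, mul_left_comm (u _)] at h1 h2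
  rw [integral_const_mul] at h1 h2
  rw [hU.inner_fourierBasis, hG.inner_fourierBasis]
  have h1' : ∫ x, g x * Real.cos (phase b n x) ∂(cellMeasure b)
      = 2 * Real.pi * freq b n j * ∫ x, u x * Real.sin (phase b n x) ∂(cellMeasure b) := by
    linarith
  have h2' : ∫ x, g x * Real.sin (phase b n x) ∂(cellMeasure b)
      = -(2 * Real.pi * freq b n j * ∫ x, u x * Real.cos (phase b n x) ∂(cellMeasure b)) := by
    linarith
  rw [h1', h2']
  push_cast
  linear_combination (2 * Real.pi * freq b n j *
    (∫ x, u x * Real.sin (phase b n x) ∂(cellMeasure b) : ℝ) : ℂ) * Complex.I_sq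

/-- A complex tensor field which agrees almost everywhere with a real one. -/
def RepresentsTensor (w : CTensorField b) (e : Space d → Tensor2 d) : Prop :=
  ∀ i j, Represents b (w (i, j)) fun x => e x i j

lemma RepresentsTensor.traceOp {w : CTensorField b} {e : Space d → Tensor2 d}
    (h : RepresentsTensor w e) : Represents b (traceOp b w) fun x => (e x).trace := by
  rw [traceOp_apply]
  exact Represents.sum _ fun i => h i i

lemma Represents.sphericalOp {F : CField b} {f : Space d → ℝ} (h : Represents b F f) :
    RepresentsTensor (sphericalOp b F) fun x => f x • (1 : Tensor2 d) := by
  intro i j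
  rw [sphericalOp_apply]
  by_cases hij : i = j
  · simpa [hij] using h
  · simpa [hij] using represents_zero

lemma RepresentsTensor.sphOp {w : CTensorField b} {e : Space d → Tensor2 d}
    (h : RepresentsTensor w e) : RepresentsTensor (sphOp b w) fun x => sph (e x) := by
  intro i j
  have h1 := (h.traceOp.sphericalOp i j).smul (d : ℝ)⁻¹
  have h2 : PeriodicElasticity.sphOp b w (i, j)
      = (((d : ℝ)⁻¹ : ℝ) : ℂ) •
        PeriodicElasticity.sphericalOp b (PeriodicElasticity.traceOp b w) (i, j) := by
    push_cast; rfl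
  rw [h2]
  refine h1.congr (Eventually.of_forall fun x => ?_)
  simp only [sph, Matrix.smul_apply, smul_eq_mul]
  ring

lemma RepresentsTensor.add {w w' : CTensorField b} {e e' : Space d → Tensor2 d}
    (h : RepresentsTensor w e) (h' : RepresentsTensor w' e') :
    RepresentsTensor (w + w') fun x => e x + e' x :=
  fun i j => (h i j).add (h' i j)

lemma RepresentsTensor.stressOp {w : CTensorField b} {e : Space d → Tensor2 d}
    (h : RepresentsTensor w e) {κ μ : Space d → ℝ} (hκ : MemLp κ ⊤ (cellMeasure b))
    (hμ : MemLp μ ⊤ (cellMeasure b)) :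
    RepresentsTensor (stressOp b hκ hμ w) fun x => stress (κ x) (μ x) (e x) := by
  intro i j
  have h1 := ((h.sphOp i j).smul d).mulOp hκ
  have h2 := (((h i j).sub (h.sphOp i j)).smul 2).mulOp hμ
  have h3 := h1.add h2
  have e1 : PeriodicElasticity.stressOp b hκ hμ w (i, j)
      = PeriodicElasticity.mulOp b hκ (((d : ℝ) : ℂ) • PeriodicElasticity.sphOp b w (i, j))
        + PeriodicElasticity.mulOp b hμ
          (((2 : ℝ) : ℂ) • (w (i, j) - PeriodicElasticity.sphOp b w (i, j))) := by
    push_cast; rfl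
  rw [e1]
  refine h3.congr (Eventually.of_forall fun x => ?_)
  simp only [stress, dev, Matrix.smul_apply, Matrix.add_apply, Matrix.sub_apply, smul_eq_mul]
  ring

lemma RepresentsTensor.constStressOp {w : CTensorField b} {e : Space d → Tensor2 d}
    (h : RepresentsTensor w e) (κ μ : ℝ) :
    RepresentsTensor (constStressOp b κ μ w) fun x => stress κ μ (e x) := by
  intro i j
  have h1 := (h.sphOp i j).smul (d * κ)
  have h2 := ((h i j).sub (h.sphOp i j)).smul (2 * μ)
  have h3 := h1.add h2
  have e1 : PeriodicElasticity.constStressOp b κ μ w (i, j)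
      = ((d * κ : ℝ) : ℂ) • PeriodicElasticity.sphOp b w (i, j)
        + ((2 * μ : ℝ) : ℂ) • (w (i, j) - PeriodicElasticity.sphOp b w (i, j)) := by
    push_cast; rfl
  rw [e1]
  exact h3

lemma RepresentsTensor.eq {w w' : CTensorField b} {e : Space d → Tensor2 d}
    (h : RepresentsTensor w e) (h' : RepresentsTensor w' e) : w = w' := by
  ext1 p
  exact (h p.1 p.2).eq (h' p.1 p.2)

end TestFunctions

/-! ### The problem for the strain fluctuation -/

section Fluctuation

open scoped InnerProductSpace

variable {d : ℕ} {b : Module.Basis (Fin d) ℝ (Space d)}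

lemma stress_add (κ κ' μ μ' : ℝ) (e : Tensor2 d) :
    stress (κ + κ') (μ + μ') e = stress κ μ e + stress κ' μ' e := by
  unfold stress
  module

lemma stress_smul_one (hd : d ≠ 0) (κ μ a : ℝ) :
    stress κ μ (a • (1 : Tensor2 d)) = (d * κ * a) • (1 : Tensor2 d) := by
  have hd' : (d : ℝ) ≠ 0 := by exact_mod_cast hd
  have : sph (a • (1 : Tensor2 d)) = a • 1 := by
    rw [sph, Matrix.trace_smul, Matrix.trace_one, Fintype.card_fin, smul_eq_mul,
      mul_div_cancel_right₀ _ hd']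
  rw [stress, dev, this, sub_self, smul_zero, add_zero, smul_smul]

lemma stress_symm (κ μ : ℝ) {e : Tensor2 d} (he : ∀ i j, e i j = e j i) (i j : Fin d) :
    stress κ μ e i j = stress κ μ e j i := by
  simp only [stress, dev, sph, Matrix.smul_apply, Matrix.add_apply, Matrix.sub_apply, he i j,
    Matrix.one_apply, eq_comm (a := i)]

variable (b) in
/-- The constant spherical field `a I`. -/
def meanField (a : ℝ) : CTensorField b := sphericalOp b ((a : ℂ) • fourierBasis b 0)

lemma representsTensor_meanField (a : ℝ) :
    RepresentsTensor (meanField b a) fun _ => a • (1 : Tensor2 d) := by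
  have := ((represents_fourierBasis_zero (b := b)).smul a).sphericalOp
  simp only [mul_one] at this
  exact this

/-- A constant field is symmetric here and has zero divergence. -/
lemma inner_meanField_eq_zero (a : ℝ) {v : CTensorField b} (hv : v ∈ compatibleFields b) :
    ⟪meanField b a, v⟫_ℂ = 0 := by
  refine inner_eq_zero_of_divergence_eq_zero b ?_ ?_ hv
  · intro i j
    simp only [meanField, sphericalOp_apply, eq_comm]
  · intro n i
    refine Finset.sum_eq_zero fun j _ => ?_
    by_cases hn : n = 0
    · simp [hn, freq]
    · rw [meanField, sphericalOp_apply]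
      split_ifs
      · rw [inner_smul_right, (fourierBasis b).orthonormal.2 hn]
        simp
      · simp

/-- The complexified equations satisfied by the fluctuation of a strain field solution. -/
lemma exists_fluctuation (hd : d ≠ 0) {κ₀ μ₀ a : ℝ} {k m : Space d → ℝ}
    (hk : MemLp k ⊤ (cellMeasure b)) (hm : MemLp m ⊤ (cellMeasure b)) {κ μ : Space d → ℝ}
    (hκ : ∀ x, κ x = κ₀ + k x) (hμ : ∀ x, μ x = μ₀ + m x) {e : Space d → Tensor2 d}
    (he : IsStrainSolution b κ μ (a • 1) e) :
    ∃ w ∈ compatibleFields b, RepresentsTensor w (fun x => e x - a • 1) ∧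
      ∀ v ∈ compatibleFields b,
        ⟪constStressOp b κ₀ μ₀ w + stressOp b hk hm (meanField b a + w), v⟫_ℂ = 0 := by
  obtain ⟨-, ⟨u, G, hu, hG, heq⟩, hequil⟩ := he
  choose U hU using fun i => exists_represents (hu i).2
  choose Γ hΓ using fun i j => exists_represents (hG i j).1.2
  set w : CTensorField b :=
    WithLp.toLp 2 fun p => ((2⁻¹ : ℝ) : ℂ) • (Γ p.1 p.2 + Γ p.2 p.1) with hw
  have hwe : RepresentsTensor w (fun x => e x - a • 1) := fun i j => by
    refine (((hΓ i j).add (hΓ j i)).smul 2⁻¹).congr ?_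
    filter_upwards [heq] with x hx
    rw [Matrix.sub_apply, hx i j]
    ring
  have hwK : w ∈ compatibleFields b := by
    rw [mem_compatibleFields]
    intro n
    -- The factor is half of `2πi`, from the symmetrization.
    refine ⟨fun i => Real.pi * Complex.I * ⟪fourierBasis b n, U i⟫_ℂ, fun i j => ?_⟩
    simp only [hw]
    rw [inner_smul_right, inner_add_right,
      inner_fourierBasis_of_hasWeakPartial (hU i) (hΓ i j) (hG i j).2,
      inner_fourierBasis_of_hasWeakPartial (hU j) (hΓ j i) (hG j i).2]
    push_cast
    ring
  refine ⟨w, hwK, hwe, fun v hv => ?_⟩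
  set σ := constStressOp b κ₀ μ₀ (meanField b a + w) + stressOp b hk hm (meanField b a + w)
    with hσ
  have hrep : RepresentsTensor (meanField b a + w) e := by
    have h1 := (representsTensor_meanField (b := b) a).add hwe
    simpa using h1
  have hσrep : RepresentsTensor σ (fun x => stress (κ x) (μ x) (e x)) := by
    have h1 := (hrep.constStressOp κ₀ μ₀).add (hrep.stressOp hk hm)
    simpa only [hκ, hμ, stress_add] using h1
  have hσv : ⟪σ, v⟫_ℂ = 0 := by
    refine inner_eq_zero_of_divergence_eq_zero b ?_ ?_ hv
    · intro i j
      refine (hσrep i j).eq ((hσrep j i).congr ?_)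
      filter_upwards [heq] with x hx
      refine stress_symm _ _ (fun i j => ?_) j i
      rw [hx i j, hx j i, add_comm (G j i x)]
      congr 1
      simp only [Matrix.smul_apply, Matrix.one_apply, eq_comm]
    · intro n i
      have h1 := hequil i _ (isTest_sin b n)
      have h2 := hequil i _ (isTest_cos b n)
      simp only [partialDeriv_cos, partialDeriv_sin, mul_left_comm (stress _ _ _ _ _)] at h1 h2
      rw [integral_finsetSum _ fun j _ => ((hσrep i j).integrable_mul_cos n).const_mul _] at h1
      rw [integral_finsetSum _ fun j _ => ((hσrep i j).integrable_mul_sin n).const_mul _] at h2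
      simp only [integral_const_mul] at h1 h2
      simp only [mul_assoc, neg_mul, Finset.sum_neg_distrib, ← Finset.mul_sum] at h1 h2
      have hpi : (2 * Real.pi) ≠ 0 := by positivity
      have h1' : ∑ j, freq b n j * ∫ x, stress (κ x) (μ x) (e x) i j * Real.cos (phase b n x)
          ∂(cellMeasure b) = 0 := by
        rw [← mul_assoc] at h1
        exact (mul_eq_zero.mp h1).resolve_left hpi
      have h2' : ∑ j, freq b n j * ∫ x, stress (κ x) (μ x) (e x) i j * Real.sin (phase b n x)
          ∂(cellMeasure b) = 0 := by
        rw [neg_eq_zero, ← mul_assoc] at h2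
        exact (mul_eq_zero.mp h2).resolve_left hpi
      simp only [(hσrep i _).inner_fourierBasis, mul_sub, Finset.sum_sub_distrib, ← mul_assoc,
        ← Finset.sum_mul]
      simp only [← Complex.ofReal_mul, ← Complex.ofReal_sum]
      rw [h1', h2']
      simp
  have hmean : constStressOp b κ₀ μ₀ (meanField b a) = meanField b (d * κ₀ * a) := by
    refine ((representsTensor_meanField (b := b) a).constStressOp κ₀ μ₀).eq ?_
    simp only [stress_smul_one hd]
    exact representsTensor_meanField _
  rw [hσ, map_add, hmean, add_assoc, inner_add_left, inner_meanField_eq_zero _ hv, zero_add] at hσv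
  exact hσv

/-- The response to a constant spherical field. -/
lemma stressOp_meanField (hd : d ≠ 0) (a : ℝ) {k m : Space d → ℝ}
    (hk : MemLp k ⊤ (cellMeasure b)) (hm : MemLp m ⊤ (cellMeasure b)) {g : CField b}
    (hg : Represents b g fun x => d * a * k x) :
    stressOp b hk hm (meanField b a) = sphericalOp b g := by
  refine ((representsTensor_meanField (b := b) a).stressOp hk hm).eq ?_
  simp only [stress_smul_one hd]
  convert hg.sphericalOp using 3
  ring

end Fluctuation

/-! ### Pointwise control and homogeneity of the contrast -/

section Contrast

variable {d : ℕ} {b : Module.Basis (Fin d) ℝ (Space d)}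

lemma contrast_nonneg (κ₀ μ₀ : ℝ) (κ μ : Space d → ℝ) : 0 ≤ contrast b κ₀ μ₀ κ μ :=
  ENNReal.toReal_nonneg

lemma ae_abs_le_contrast (hd : d ≠ 0) {κ₀ μ₀ : ℝ} {k m κ μ : Space d → ℝ}
    (hk : MemLp k ⊤ (cellMeasure b)) (hm : MemLp m ⊤ (cellMeasure b))
    (hκ : ∀ x, κ x = κ₀ + k x) (hμ : ∀ x, μ x = μ₀ + m x) :
    ∀ᵐ x ∂(cellMeasure b),
      |k x| ≤ contrast b κ₀ μ₀ κ μ ∧ |m x| ≤ contrast b κ₀ μ₀ κ μ := by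
  set f : Space d → ℝ := fun x => max |(d : ℝ) * (κ x - κ₀)| |2 * (μ x - μ₀)| with hf
  -- Boundedness matters: `contrast` is a `toReal`, which would be `0` for an infinite supremum.
  have hmem : MemLp f ⊤ (cellMeasure b) := by
    have h := ((hk.const_mul (d : ℝ)).norm).sup ((hm.const_mul 2).norm)
    refine h.ae_eq (Eventually.of_forall fun x => ?_)
    simp [hf, hκ, hμ]
  have hle : ∀ᵐ x ∂(cellMeasure b), ‖f x‖ ≤ contrast b κ₀ μ₀ κ μ := by
    filter_upwards [enorm_ae_le_eLpNormEssSup f (cellMeasure b)] with x hx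
    rw [← eLpNorm_exponent_top] at hx
    rw [← toReal_enorm]
    exact ENNReal.toReal_mono hmem.eLpNorm_ne_top hx
  filter_upwards [hle] with x hx
  have h1 : |(d : ℝ) * k x| ≤ f x := by
    simp only [hf, hκ, add_sub_cancel_left]
    exact le_max_left _ _
  have h2 : |2 * m x| ≤ f x := by
    simp only [hf, hμ, add_sub_cancel_left]
    exact le_max_right _ _
  have h3 := (Real.le_norm_self (f x)).trans hx
  rw [abs_mul, Nat.abs_cast] at h1
  rw [abs_mul, abs_two] at h2
  have hd1 : (1 : ℝ) ≤ d := by exact_mod_cast Nat.one_le_iff_ne_zero.mpr hd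
  exact ⟨by nlinarith [abs_nonneg (k x)], by linarith [abs_nonneg (m x)]⟩

lemma contrast_scaled {κ₀ μ₀ t : ℝ} {k m κ μ : Space d → ℝ}
    (hκ : ∀ x, κ x = κ₀ + t * k x) (hμ : ∀ x, μ x = μ₀ + t * m x) :
    contrast b κ₀ μ₀ κ μ = |t| * contrast b κ₀ μ₀ (fun x => κ₀ + k x) (fun x => μ₀ + m x) := by
  have : (fun x => max |(d : ℝ) * (κ x - κ₀)| |2 * (μ x - μ₀)|) = |t| •
      fun x => max |(d : ℝ) * (κ₀ + k x - κ₀)| |2 * (μ₀ + m x - μ₀)| := by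
    funext x
    simp only [hκ, hμ, add_sub_cancel_left, Pi.smul_apply, smul_eq_mul]
    rw [mul_max_of_nonneg _ _ (abs_nonneg t), ← abs_mul, ← abs_mul]
    congr 2 <;> ring
  rw [contrast, this, eLpNorm_const_smul, ENNReal.toReal_mul, toReal_enorm, Real.norm_eq_abs,
    abs_abs]
  rfl

end Contrast

/-! ### Algebra of the equivalent strain and of the reconstruction formulae -/

section Pointwise

variable {d : ℕ}

lemma sph_smul_one (hd : d ≠ 0) (a : ℝ) : sph (a • (1 : Tensor2 d)) = a • 1 := by
  have hd' : (d : ℝ) ≠ 0 := by exact_mod_cast hd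
  rw [sph, Matrix.trace_smul, Matrix.trace_one, Fintype.card_fin, smul_eq_mul,
    mul_div_cancel_right₀ _ hd']

lemma dev_sub_smul_one (hd : d ≠ 0) (a : ℝ) (e : Tensor2 d) : dev (e - a • 1) = dev e := by
  have : sph (e - a • (1 : Tensor2 d)) = sph e - a • 1 := by
    have h := sph_smul_one hd a
    rw [sph] at h
    rw [sph, sph, Matrix.trace_sub, sub_div, sub_smul, h]
  rw [dev, dev, this]
  abel

/-- The deviator does not see `a I`. Each of its `d ^ 2` entries exceeds the entry of `e - a I` by
at most the full sum, whence the crude constant. -/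
lemma abs_equivalentStrain_le (hd : d ≠ 0) (a : ℝ) (e : Tensor2 d) :
    |equivalentStrain e| ≤ (1 + d ^ 2) * ∑ i, ∑ j, |(e - a • (1 : Tensor2 d)) i j| := by
  have hd0 : (0 : ℝ) < d := by exact_mod_cast Nat.pos_of_ne_zero hd
  have hd1 : (1 : ℝ) ≤ d := by exact_mod_cast Nat.one_le_iff_ne_zero.mpr hd
  rw [equivalentStrain, ← dev_sub_smul_one hd a e]
  set w := e - a • (1 : Tensor2 d)
  set s := ∑ i, ∑ j, |w i j| with hs
  have hs0 : 0 ≤ s := by positivity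
  have htr : |w.trace| ≤ s := by
    refine (Finset.abs_sum_le_sum_abs _ _).trans (Finset.sum_le_sum fun i _ => ?_)
    exact Finset.single_le_sum (f := fun j => |w i j|) (fun j _ => abs_nonneg _) (Finset.mem_univ i)
  have hdev : ∀ i j, |dev w i j| ≤ |w i j| + s := fun i j => by
    rw [dev, Matrix.sub_apply]
    refine (abs_sub _ _).trans (add_le_add_right ?_ _)
    rw [sph, Matrix.smul_apply, smul_eq_mul, abs_mul, abs_div, abs_of_pos hd0]
    have h1 : |(1 : Tensor2 d) i j| ≤ 1 := by
      rw [Matrix.one_apply]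
      split_ifs <;> simp
    have h2 : |w.trace| / d ≤ s := (div_le_self (abs_nonneg _) hd1).trans htr
    calc |w.trace| / d * |(1 : Tensor2 d) i j| ≤ s * 1 := by gcongr
      _ = s := mul_one s
  have hsum : ∑ i, ∑ j, |dev w i j| ≤ (1 + d ^ 2) * s := by
    refine (Finset.sum_le_sum fun i _ => Finset.sum_le_sum fun j _ => hdev i j).trans ?_
    simp only [Finset.sum_add_distrib, Finset.sum_const, Finset.card_univ, Fintype.card_fin,
      nsmul_eq_mul]
    rw [← hs]
    apply le_of_eq; ring
  rw [abs_of_nonneg (Real.sqrt_nonneg _)]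
  refine Real.sqrt_le_iff.mpr ⟨by positivity, ?_⟩
  have hdd : ddot (dev w) (dev w) ≤ (∑ i, ∑ j, |dev w i j|) ^ 2 := by
    rw [ddot, ← Fintype.sum_prod_type' fun i j => dev w i j * dev w i j,
      ← Fintype.sum_prod_type' fun i j => |dev w i j|]
    refine le_trans (le_of_eq ?_) (Finset.sum_sq_le_sq_sum_of_nonneg fun p _ => abs_nonneg _)
    exact Finset.sum_congr rfl fun p _ => by rw [sq_abs, sq]
  have hdd0 : 0 ≤ ddot (dev w) (dev w) :=
    Finset.sum_nonneg fun i _ => Finset.sum_nonneg fun j _ => mul_self_nonneg _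
  have hfrac : ((d : ℝ) - 1) / d ≤ 1 := by rw [div_le_one hd0]; linarith
  calc ((d : ℝ) - 1) / d * ddot (dev w) (dev w) ≤ 1 * ddot (dev w) (dev w) := by gcongr
    _ ≤ (∑ i, ∑ j, |dev w i j|) ^ 2 := by rw [one_mul]; exact hdd
    _ ≤ ((1 + d ^ 2) * s) ^ 2 := pow_le_pow_left₀ (by positivity) hsum 2

lemma bulkFromHydrostatic_eq (hd : d ≠ 0) {a : ℝ} (ha : a ≠ 0) (κ₀ μ₀ : ℝ) (e : Tensor2 d) :
    bulkFromHydrostatic κ₀ μ₀ (a • 1) e = bulkFromTrace κ₀ μ₀ (a • 1) e := by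
  have hd' : (d : ℝ) ≠ 0 := by exact_mod_cast hd
  have h1 : (a • (1 : Tensor2 d)).trace = a * d := by simp
  have h2 : ddot (a • (1 : Tensor2 d)) (a • 1) = a ^ 2 * d := by
    simp [ddot, Matrix.one_apply]
    ring
  rw [bulkFromHydrostatic, bulkFromTrace, hydrostatic, hydrostatic, h1, h2]
  congr 3
  field_simp

/-- Identifies the reconstruction error with the combination bounded in `norm_traceOp_add_le`. -/
lemma sub_bulkFromTrace (hd : d ≠ 0) {a : ℝ} (ha : a ≠ 0) (κ₀ μ₀ k : ℝ) (e : Tensor2 d) :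
    κ₀ + k - bulkFromTrace κ₀ μ₀ (a • 1) e
      = (d * a)⁻¹ * (lamJInv d κ₀ μ₀ / d * (e - a • (1 : Tensor2 d)).trace + d * a * k) := by
  have hd' : (d : ℝ) ≠ 0 := by exact_mod_cast hd
  have h1 : (a • (1 : Tensor2 d)).trace = a * d := by simp
  have h2 : ddot (a • (1 : Tensor2 d)) (a • 1) = a ^ 2 * d := by
    simp [ddot, Matrix.one_apply]
    ring
  rw [bulkFromTrace, Matrix.trace_sub, h1, h2]
  field_simp
  ring

end Pointwise

/-! ### Estimates in `L²` -/

section Estimates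

open scoped InnerProductSpace

variable {d : ℕ} (b : Module.Basis (Fin d) ℝ (Space d))

/-- The stress `δL w` left over in the trace estimate is a product of two first-order quantities.
The constants depend only on the reference problem, which gives uniformity over media. -/
lemma exists_fluctuation_estimates (hd : d ≠ 0) {κ₀ μ₀ a : ℝ} (hκ₀ : 0 < κ₀) (hμ₀ : 0 < μ₀)
    (ha : a ≠ 0) : ∃ C r : ℝ, 0 ≤ C ∧ 0 < r ∧
      ∀ (k m κ μ : Space d → ℝ) (e : Space d → Tensor2 d),
        MemLp k ⊤ (cellMeasure b) → MemLp m ⊤ (cellMeasure b) →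
        (∀ x, κ x = κ₀ + k x) → (∀ x, μ x = μ₀ + m x) →
        contrast b κ₀ μ₀ κ μ ≤ r → IsStrainSolution b κ μ (a • 1) e →
        (∀ i j, ∃ F : CField b, Represents b F (fun x => (e x - a • (1 : Tensor2 d)) i j) ∧
          ‖F‖ ≤ C * contrast b κ₀ μ₀ κ μ) ∧
        (∫ x, k x ∂(cellMeasure b) = 0 →
          ∃ F : CField b, Represents b F (fun x => κ x - bulkFromTrace κ₀ μ₀ (a • 1) (e x)) ∧
            ‖F‖ ≤ C * contrast b κ₀ μ₀ κ μ ^ 2) := by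
  have hd0 : (0 : ℝ) < d := by exact_mod_cast Nat.pos_of_ne_zero hd
  obtain ⟨A, hA, hAle⟩ := exists_norm_stressOp_le b
  set c := min (d * κ₀) (2 * μ₀) with hc
  have hc0 : 0 < c := lt_min (by positivity) (by positivity)
  set B := 2 * A / c * ‖meanField b a‖ with hB
  have hB0 : 0 ≤ B := by positivity
  set D := |(d * a)⁻¹| * (A * B) with hD
  refine ⟨max B D, c / (2 * A), hB0.trans (le_max_left _ _), by positivity, ?_⟩
  intro k m κ μ e hk hm hκ hμ hr he
  set q := contrast b κ₀ μ₀ κ μ with hq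
  have hq0 : 0 ≤ q := contrast_nonneg _ _ _ _
  have hae := ae_abs_le_contrast (b := b) hd hk hm hκ hμ
  have hδ : ‖stressOp b hk hm‖ ≤ A * q :=
    hAle hk hm hq0 (hae.mono fun x hx => hx.1) (hae.mono fun x hx => hx.2)
  obtain ⟨w, hwK, hwe, hw⟩ := exists_fluctuation hd hk hm hκ hμ he
  have h1 : c * ‖w‖ ≤ A * q * (‖meanField b a‖ + ‖w‖) :=
    (coercive_estimate (constStressOp_coercive b) hwK hw).trans
      (((stressOp b hk hm).le_of_opNorm_le hδ _).trans (by gcongr; exact norm_add_le _ _))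
  -- The choice of `r` lets half of `c * ‖w‖` absorb the term `A * q * ‖w‖`.
  have hqA : A * q ≤ c / 2 := by
    rw [le_div_iff₀ (by positivity)] at hr
    linarith
  have hwle : ‖w‖ ≤ B * q := by
    have h2 : c * ‖w‖ ≤ c * (B * q) := by
      have : c * (B * q) = 2 * (A * q * ‖meanField b a‖) := by
        rw [hB]; field_simp
      rw [this]
      nlinarith [norm_nonneg w]
    exact le_of_mul_le_mul_left h2 hc0
  refine ⟨fun i j => ⟨w (i, j), hwe i j, ?_⟩, fun hint => ?_⟩
  · refine (PiLp.norm_apply_le w (i, j)).trans (hwle.trans ?_)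
    gcongr
    exact le_max_left _ _
  · obtain ⟨g₀, hg₀⟩ := exists_represents (hk.mono_exponent (le_top : (2 : ENNReal) ≤ ⊤))
    set g := ((d * a : ℝ) : ℂ) • g₀ with hg
    have hgrep : Represents b g fun x => d * a * k x := hg₀.smul _
    have hg0 : ⟪fourierBasis b 0, g⟫_ℂ = 0 := by
      rw [hgrep.inner_fourierBasis]
      simp [phase, integral_const_mul, hint]
    have h3 := norm_traceOp_add_le b hd (κ₀ := κ₀) (μ₀ := μ₀) (τ := stressOp b hk hm w)
      hwK hg0 (by rwa [map_add, stressOp_meanField hd a hk hm hgrep] at hw)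
    refine ⟨(((d * a)⁻¹ : ℝ) : ℂ) • (((lamJInv d κ₀ μ₀ / d : ℝ) : ℂ) • traceOp b w + g), ?_, ?_⟩
    · refine (((hwe.traceOp.smul _).add hgrep).smul _).congr (Eventually.of_forall fun x => ?_)
      simp only [hκ]
      rw [sub_bulkFromTrace hd ha]
    · rw [norm_smul, Complex.norm_real, Real.norm_eq_abs]
      have h4 : ‖stressOp b hk hm w‖ ≤ A * q * (B * q) :=
        ((stressOp b hk hm).le_of_opNorm_le hδ _).trans (by gcongr)
      calc |(d * a)⁻¹| * _ ≤ |(d * a)⁻¹| * (A * q * (B * q)) := by gcongr; exact h3.trans h4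
        _ = D * q ^ 2 := by rw [hD]; ring
        _ ≤ _ := by gcongr; exact le_max_right _ _

end Estimates

/-! ### Neumann series at almost every point -/

section Neumann

variable {d : ℕ} {b : Module.Basis (Fin d) ℝ (Space d)}

/-- On a probability space the `L¹` norm is at most the `L²` norm, so the sum of the moduli has
finite integral. -/
lemma ae_summable_norm_of_summable_norm {f : ℕ → CField b} (hf : Summable fun n => ‖f n‖) :
    ∀ᵐ x ∂(cellMeasure b), Summable fun n => ‖f n x‖ := by
  have hmeas : ∀ n, AEMeasurable (fun x => ‖f n x‖ₑ) (cellMeasure b) := fun n =>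
    (Lp.aestronglyMeasurable (f n)).enorm
  have hfin : ∫⁻ x, ∑' n, ‖f n x‖ₑ ∂(cellMeasure b) ≠ ⊤ := by
    rw [lintegral_tsum hmeas]
    refine ne_top_of_le_ne_top hf.tsum_ofReal_ne_top (ENNReal.tsum_le_tsum fun n => ?_)
    rw [ofReal_norm, Lp.enorm_def, ← eLpNorm_one_eq_lintegral_enorm]
    exact eLpNorm_le_eLpNorm_of_exponent_le (by norm_num) (Lp.aestronglyMeasurable (f n))
  filter_upwards [ae_lt_top' (AEMeasurable.tsum hmeas) hfin] with x hx
  have := ENNReal.summable_toReal hx.ne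
  simpa only [toReal_enorm] using this

lemma eq_sum_pow_add_of_eq_add {H : Type*} [NormedAddCommGroup H] [NormedSpace ℂ H]
    {N : H →L[ℂ] H} {E W : H} {t : ℂ} (h : W = E + t • N W) (n : ℕ) :
    W = ∑ q ∈ Finset.range n, t ^ q • (N ^ q) E + t ^ n • (N ^ n) W := by
  induction n with
  | zero => simp
  | succ n ih =>
    have h1 : (N ^ n) W = (N ^ n) E + t • (N ^ (n + 1)) W := by
      conv_lhs => rw [h]
      rw [map_add, map_smul, pow_succ]
      rfl
    rw [Finset.sum_range_succ, add_assoc, pow_succ t, mul_smul, ← smul_add, ← h1]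
    exact ih

/-- The second-order remainder of a Neumann series is bounded at almost every point. -/
lemma exists_pointwise_remainder_bound (N : CTensorField b →L[ℂ] CTensorField b)
    (E : CTensorField b) {s : ℝ} (hs : 0 ≤ s) (hsN : s * ‖N‖ ≤ 1 / 2) (p : Fin d × Fin d) :
    ∃ G : Space d → ℝ, ∀ (t : ℝ) (W : CTensorField b), |t| ≤ s → W = E + (t : ℂ) • N W →
      ∀ᵐ x ∂(cellMeasure b), ‖W p x - E p x - t * N E p x‖ ≤ t ^ 2 * G x := by
  have hpow : ∀ (q : ℕ) (X : CTensorField b), ‖((N ^ q) X) p‖ ≤ ‖N‖ ^ q * ‖X‖ := fun q X =>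
    (PiLp.norm_apply_le _ p).trans (by
      induction q with
      | zero => simp
      | succ q ih =>
        rw [pow_succ', pow_succ', mul_assoc]
        exact (N.le_opNorm _).trans (mul_le_mul_of_nonneg_left ih (norm_nonneg N)))
  -- Used with `c = 2` for the tail of the series, and with `c = 0` to make the remainder `t ^ n N ^
  -- n W` tend to zero pointwise.
  have hsum : ∀ (c : ℕ) (X : CTensorField b) (t : ℝ), |t| ≤ s →
      Summable fun q : ℕ => ‖((t : ℂ) ^ q) • ((N ^ (q + c)) X) p‖ := fun c X t ht => by
    refine Summable.of_nonneg_of_le (fun q => norm_nonneg _) (fun q => ?_)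
      ((summable_geometric_of_lt_one (by norm_num) (by norm_num : (1 / 2 : ℝ) < 1)).mul_right
        (‖N‖ ^ c * ‖X‖))
    rw [norm_smul, norm_pow, Complex.norm_real, Real.norm_eq_abs]
    calc |t| ^ q * ‖((N ^ (q + c)) X) p‖ ≤ s ^ q * (‖N‖ ^ (q + c) * ‖X‖) := by
          gcongr; exact hpow _ _
      _ = (s * ‖N‖) ^ q * (‖N‖ ^ c * ‖X‖) := by rw [mul_pow, pow_add]; ring
      _ ≤ _ := by gcongr
  -- Taking the largest amplitude `s` makes the bound independent of `t`. Where the series diverges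
  -- the sum is the default `0`, but `hG` confines this to a null set.
  refine ⟨fun x => ∑' q, ‖(((s : ℂ) ^ q) • ((N ^ (q + 2)) E) p : CField b) x‖,
    fun t W ht hW => ?_⟩
  have hG := ae_summable_norm_of_summable_norm (hsum 2 E s (by rw [abs_of_nonneg hs]))
  have hR := ae_summable_norm_of_summable_norm (hsum 0 W t ht)
  have hexp : ∀ᵐ x ∂(cellMeasure b), ∀ n : ℕ, W p x =
      ∑ q ∈ Finset.range n, (t : ℂ) ^ q * ((N ^ q) E) p x
        + (((t : ℂ) ^ n) • ((N ^ (n + 0)) W) p : CField b) x := by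
    refine ae_all_iff.mpr fun n => ?_
    have h1 : W p = ∑ q ∈ Finset.range n, (t : ℂ) ^ q • ((N ^ q) E) p
        + (t : ℂ) ^ n • ((N ^ n) W) p := by
      have := congrArg (PiLp.proj 2 (fun _ : Fin d × Fin d => CField b) p (𝕜 := ℂ))
        (eq_sum_pow_add_of_eq_add hW n)
      simpa only [map_add, map_sum, map_smul, PiLp.proj_apply] using this
    have h2 : ∀ᵐ x ∂(cellMeasure b), ∀ q : ℕ,
        ((t : ℂ) ^ q • ((N ^ q) E) p : CField b) x = (t : ℂ) ^ q * ((N ^ q) E) p x :=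
      ae_all_iff.mpr fun q => by
        filter_upwards [Lp.coeFn_smul ((t : ℂ) ^ q) (((N ^ q) E) p)] with x hx
        rw [hx, Pi.smul_apply, smul_eq_mul]
    have h3 := Lp.coeFn_add (∑ q ∈ Finset.range n, (t : ℂ) ^ q • ((N ^ q) E) p)
      ((t : ℂ) ^ n • ((N ^ n) W) p)
    have h4 := Lp.coeFn_finsetSum (Finset.range n) fun q => (t : ℂ) ^ q • ((N ^ q) E) p
    rw [← h1] at h3
    filter_upwards [h2, h3, h4] with x h2 h3 h4
    rw [h3, Pi.add_apply, h4, Finset.sum_apply]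
    simp only [h2, add_zero]
  have hsm : ∀ᵐ x ∂(cellMeasure b), ∀ q : ℕ,
      (((s : ℂ) ^ q) • ((N ^ (q + 2)) E) p : CField b) x = (s : ℂ) ^ q * ((N ^ (q + 2)) E) p x :=
    ae_all_iff.mpr fun q => by
      filter_upwards [Lp.coeFn_smul ((s : ℂ) ^ q) (((N ^ (q + 2)) E) p)] with x hx
      rw [hx, Pi.smul_apply, smul_eq_mul]
  filter_upwards [hG, hR, hexp, hsm] with x hG hR hexp hsm
  set G := ∑' q, ‖(((s : ℂ) ^ q) • ((N ^ (q + 2)) E) p : CField b) x‖ with hGdef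
  set ρ : ℕ → ℝ := fun n => ‖(((t : ℂ) ^ n) • ((N ^ (n + 0)) W) p : CField b) x‖ with hρ
  have hρ0 : Tendsto (fun n => t ^ 2 * G + ρ (n + 2)) atTop (𝓝 (t ^ 2 * G)) := by
    have := (tendsto_add_atTop_iff_nat 2).mpr hR.tendsto_atTop_zero
    simpa using this.const_add (t ^ 2 * G)
  refine ge_of_tendsto' hρ0 fun n => ?_
  have h1 := hexp (n + 2)
  rw [Finset.sum_range_succ', Finset.sum_range_succ'] at h1
  have h2 : W p x - E p x - t * N E p x
      = t ^ 2 * ∑ q ∈ Finset.range n, (t : ℂ) ^ q * ((N ^ (q + 2)) E) p x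
        + (((t : ℂ) ^ (n + 2)) • ((N ^ (n + 2 + 0)) W) p : CField b) x := by
    rw [h1, Finset.mul_sum]
    have e1 : ∀ q : ℕ, (t : ℂ) ^ (q + 1 + 1) * ((N ^ (q + 1 + 1)) E) p x
        = t ^ 2 * ((t : ℂ) ^ q * ((N ^ (q + 2)) E) p x) := fun q => by
      rw [show q + 1 + 1 = q + 2 from rfl, pow_add]; ring
    simp only [e1, zero_add, pow_one, pow_zero, one_apply_eq_self]
    ring
  rw [h2]
  refine (norm_add_le _ _).trans (add_le_add_left ?_ _)
  rw [norm_mul, norm_pow, Complex.norm_real, Real.norm_eq_abs, sq_abs]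
  gcongr
  refine (norm_sum_le _ _).trans (le_trans (Finset.sum_le_sum fun q _ => ?_)
    (hG.sum_le_tsum (Finset.range n) fun q _ => norm_nonneg _))
  rw [hsm q, norm_mul, norm_mul, norm_pow, norm_pow, Complex.norm_real, Complex.norm_real,
    Real.norm_eq_abs, Real.norm_eq_abs, abs_of_nonneg hs]
  gcongr

end Neumann

/-! ### Pointwise bounds for scaled fluctuations -/

section ScaledFluctuations

open scoped InnerProductSpace

variable {d : ℕ} {b : Module.Basis (Fin d) ℝ (Space d)}

lemma stressOp_const_mul {k m : Space d → ℝ} (hk : MemLp k ⊤ (cellMeasure b))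
    (hm : MemLp m ⊤ (cellMeasure b)) (t : ℝ) {w : CTensorField b} {e : Space d → Tensor2 d}
    (h : RepresentsTensor w e) :
    stressOp b (hk.const_mul t) (hm.const_mul t) w = (t : ℂ) • stressOp b hk hm w := by
  refine (h.stressOp (hk.const_mul t) (hm.const_mul t)).eq fun i j => ?_
  refine ((h.stressOp hk hm i j).smul t).congr (Eventually.of_forall fun x => ?_)
  simp only [stress, Matrix.add_apply, Matrix.smul_apply, smul_eq_mul]
  ring

/-- Bounds at almost every point, for fluctuations of the moduli of amplitude `t`. -/
lemma exists_pointwise_bounds (hd : d ≠ 0) {κ₀ μ₀ a : ℝ} (hκ₀ : 0 < κ₀) (hμ₀ : 0 < μ₀)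
    (ha : a ≠ 0) {k m : Space d → ℝ} (hk : MemLp k ⊤ (cellMeasure b))
    (hm : MemLp m ⊤ (cellMeasure b)) :
    ∃ (s : ℝ) (B G : Space d → ℝ), 0 < s ∧ ∀ (t : ℝ) (κ μ : Space d → ℝ) (e : Space d → Tensor2 d),
      |t| ≤ s → (∀ x, κ x = κ₀ + t * k x) → (∀ x, μ x = μ₀ + t * m x) →
      IsStrainSolution b κ μ (a • 1) e → ∀ᵐ x ∂(cellMeasure b),
        (∀ i j, |(e x - a • (1 : Tensor2 d)) i j| ≤ |t| * B x) ∧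
        (∫ x, k x ∂(cellMeasure b) = 0 →
          |κ x - bulkFromTrace κ₀ μ₀ (a • 1) (e x)| ≤ t ^ 2 * G x) := by
  have hd0 : (0 : ℝ) < d := by exact_mod_cast Nat.pos_of_ne_zero hd
  have hc0 : 0 < min (d * κ₀) (2 * μ₀) := lt_min (by positivity) (by positivity)
  obtain ⟨S, hS⟩ := exists_solutionOperator (K := compatibleFields b) hc0
    (constStressOp_coercive b)
  set N := S ∘L stressOp b hk hm with hN
  set E := meanField b a with hE
  set s := 1 / (2 * (‖N‖ + 1)) with hs
  have hs0 : 0 < s := by positivity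
  have hsN : s * ‖N‖ ≤ 1 / 2 := by
    rw [hs, div_mul_eq_mul_div, div_le_div_iff₀ (by positivity) (by norm_num)]
    linarith
  choose G hG using exists_pointwise_remainder_bound N E hs0.le hsN
  obtain ⟨g₀, hg₀⟩ := exists_represents (hk.mono_exponent (le_top : (2 : ENNReal) ≤ ⊤))
  set g := ((d * a : ℝ) : ℂ) • g₀ with hg
  have hgrep : Represents b g fun x => d * a * k x := hg₀.smul _
  set l := lamJInv d κ₀ μ₀ / d with hl
  -- The first-order term solves the problem with stress `g I` alone, so the trace estimate holds
  -- with `τ = 0` and becomes an identity.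
  have hfirst : ∫ x, k x ∂(cellMeasure b) = 0 → ∀ᵐ x ∂(cellMeasure b),
      (l : ℂ) * (∑ i, N E (i, i) x) + (d * a * k x : ℝ) = 0 := fun hint => by
    have hg0 : ⟪fourierBasis b 0, g⟫_ℂ = 0 := by
      rw [hgrep.inner_fourierBasis]
      simp [phase, integral_const_mul, hint]
    have h1 := norm_traceOp_add_le b hd (κ₀ := κ₀) (μ₀ := μ₀) (w := N E) (τ := 0)
      (hS _).1 hg0 (by
        rw [add_zero, ← stressOp_meanField hd a hk hm hgrep]
        exact (hS _).2)
    rw [norm_zero] at h1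
    have h2 : (l : ℂ) • traceOp b (N E) + g = 0 := norm_le_zero_iff.mp h1
    rw [traceOp_apply] at h2
    have h3 := Lp.coeFn_add ((l : ℂ) • ∑ i, N E (i, i)) g
    rw [h2] at h3
    filter_upwards [h3, Lp.coeFn_zero ℂ 2 (cellMeasure b), hgrep,
      Lp.coeFn_smul (l : ℂ) (∑ i, N E (i, i)),
      Lp.coeFn_finsetSum Finset.univ fun i => N E (i, i)] with x h3 h4 h5 h6 h7
    rw [h4, Pi.add_apply, h5, h6, Pi.smul_apply, h7, Finset.sum_apply, smul_eq_mul] at h3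
    exact h3.symm
  -- One factor `|t| ≤ s` of the quadratic remainder is traded for `s` in the first-order bound.
  refine ⟨s, fun x => ∑ p, (‖N E p x‖ + s * |G p x|),
    fun x => |(d * a)⁻¹| * (|l| * ∑ i, G (i, i) x), hs0, ?_⟩
  intro t κ μ e ht hκ hμ he
  obtain ⟨w, hwK, hwe, hw⟩ :=
    exists_fluctuation hd (hk.const_mul t) (hm.const_mul t) hκ hμ he
  have hErep := representsTensor_meanField (b := b) a
  have hEw : RepresentsTensor (E + w) e := by simpa using hErep.add hwe
  rw [stressOp_const_mul hk hm t hEw] at hw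
  -- Uniqueness shows that the given solution is the one produced by `S`, hence a fixed point.
  have hwS : w = S ((t : ℂ) • stressOp b hk hm (E + w)) :=
    coercive_unique hc0 (constStressOp_coercive b) hwK (hS _).1 hw (hS _).2
  have hfix : E + w = E + (t : ℂ) • N (E + w) := by
    rw [hN, ContinuousLinearMap.comp_apply, ← map_smul, ← hwS]
  have hrem : ∀ᵐ x ∂(cellMeasure b), ∀ p : Fin d × Fin d,
      ‖(((e x - a • (1 : Tensor2 d)) p.1 p.2 : ℝ) : ℂ) - t * N E p x‖ ≤ t ^ 2 * G p x := by
    refine ae_all_iff.mpr fun p => ?_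
    filter_upwards [hG p t (E + w) ht hfix, hEw p.1 p.2, hErep p.1 p.2] with x h1 h2 h3
    rw [Prod.mk.eta] at h2 h3
    rw [h2, h3] at h1
    rwa [Matrix.sub_apply, Complex.ofReal_sub]
  have hfirst' : ∀ᵐ x ∂(cellMeasure b), ∫ x, k x ∂(cellMeasure b) = 0 →
      (l : ℂ) * (∑ i, N E (i, i) x) + (d * a * k x : ℝ) = 0 := by
    by_cases hint : ∫ x, k x ∂(cellMeasure b) = 0
    · exact (hfirst hint).mono fun x hx _ => hx
    · exact Eventually.of_forall fun x h => absurd h hint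
  filter_upwards [hrem, hfirst'] with x hrem hfirst
  refine ⟨fun i j => ?_, fun hint => ?_⟩
  · have h1 := hrem (i, j)
    have h2 : |(e x - a • (1 : Tensor2 d)) i j| ≤ t ^ 2 * G (i, j) x + |t| * ‖N E (i, j) x‖ := by
      have h3 := norm_sub_norm_le (E := ℂ)
        (((e x - a • (1 : Tensor2 d)) i j : ℝ) : ℂ) (t * N E (i, j) x)
      rw [norm_mul, Complex.norm_real, Complex.norm_real, Real.norm_eq_abs, Real.norm_eq_abs] at h3
      linarith
    have h4 : t ^ 2 * G (i, j) x ≤ |t| * (s * |G (i, j) x|) := by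
      rw [← sq_abs, sq, mul_assoc]
      exact mul_le_mul_of_nonneg_left ((mul_le_mul_of_nonneg_left (le_abs_self _)
        (abs_nonneg t)).trans (mul_le_mul_of_nonneg_right ht (abs_nonneg _))) (abs_nonneg t)
    have h5 : ‖N E (i, j) x‖ + s * |G (i, j) x| ≤ ∑ p, (‖N E p x‖ + s * |G p x|) :=
      Finset.single_le_sum (f := fun p => ‖N E p x‖ + s * |G p x|)
        (fun p _ => by positivity) (Finset.mem_univ (i, j))
    have h6 := mul_le_mul_of_nonneg_left h5 (abs_nonneg t)
    linarith
  · rw [hκ, sub_bulkFromTrace hd ha, abs_mul, mul_left_comm (t ^ 2)]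
    refine mul_le_mul_of_nonneg_left ?_ (abs_nonneg _)
    have h1 : ((l * (e x - a • (1 : Tensor2 d)).trace + d * a * (t * k x) : ℝ) : ℂ)
        = l * ∑ i, ((((e x - a • (1 : Tensor2 d)) i i : ℝ) : ℂ) - t * N E (i, i) x) := by
      have h2 := hfirst hint
      rw [Finset.sum_sub_distrib, ← Finset.mul_sum, Matrix.trace]
      simp only [Matrix.diag_apply]
      push_cast at h2 ⊢
      linear_combination (t : ℂ) * h2
    rw [← Real.norm_eq_abs, ← Complex.norm_real, h1, norm_mul, Complex.norm_real,
      Real.norm_eq_abs, mul_left_comm (t ^ 2)]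
    refine mul_le_mul_of_nonneg_left ?_ (abs_nonneg _)
    rw [Finset.mul_sum]
    exact (norm_sum_le _ _).trans (Finset.sum_le_sum fun i _ => hrem (i, i))

end ScaledFluctuations

end

end PeriodicElasticity

/-! ### The asymptotics in both senses -/

theorem proposition1 (d : ℕ) (hd : 2 ≤ d) (b : Module.Basis (Fin d) ℝ (Space d))
    (κ₀ μ₀ : ℝ) (hκ₀ : 0 < κ₀) (hμ₀ : 0 < μ₀)
    (ebar : Tensor2 d) (hsph : sph ebar = ebar) (hne : ebar ≠ 0) :
    -- expansions in `L²(𝒱)`, uniform over all media of small contrast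
    ((∀ η : ℝ, 0 < η → ∃ r : ℝ, 0 < r ∧
        ∀ (κ μ : Space d → ℝ) (e : Space d → Tensor2 d),
          IsMedium b κ μ → ∫ x, κ x ∂(cellMeasure b) = κ₀ → contrast b κ₀ μ₀ κ μ ≤ r →
          IsStrainSolution b κ μ ebar e →
          eLpNorm (fun x => κ x - bulkFromTrace κ₀ μ₀ ebar (e x)) 2 (cellMeasure b)
              ≤ ENNReal.ofReal (η * contrast b κ₀ μ₀ κ μ) ∧
          eLpNorm (fun x => κ x - bulkFromHydrostatic κ₀ μ₀ ebar (e x)) 2 (cellMeasure b)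
              ≤ ENNReal.ofReal (η * contrast b κ₀ μ₀ κ μ)) ∧
      (∃ C r : ℝ, 0 < r ∧
        ∀ (κ μ : Space d → ℝ) (e : Space d → Tensor2 d),
          IsMedium b κ μ → contrast b κ₀ μ₀ κ μ ≤ r → IsStrainSolution b κ μ ebar e →
          eLpNorm (fun x => equivalentStrain (e x)) 2 (cellMeasure b)
              ≤ ENNReal.ofReal (C * contrast b κ₀ μ₀ κ μ))) ∧
    -- expansions at almost every point, when given fluctuations are scaled down to zero
    (∀ (k m : Space d → ℝ) (t : ℕ → ℝ) (κ μ : ℕ → Space d → ℝ) (e : ℕ → Space d → Tensor2 d),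
      LpPer b ⊤ k → LpPer b ⊤ m → Tendsto t atTop (𝓝 0) →
      (∀ n x, κ n x = κ₀ + t n * k x) → (∀ n x, μ n x = μ₀ + t n * m x) →
      (∀ n, IsStrainSolution b (κ n) (μ n) ebar (e n)) →
      (∫ x, k x ∂(cellMeasure b) = 0 → ∀ᵐ x ∂(cellMeasure b),
        ((fun n => κ n x - bulkFromTrace κ₀ μ₀ ebar (e n x))
            =o[atTop] (fun n => contrast b κ₀ μ₀ (κ n) (μ n))) ∧
        ((fun n => κ n x - bulkFromHydrostatic κ₀ μ₀ ebar (e n x))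
            =o[atTop] (fun n => contrast b κ₀ μ₀ (κ n) (μ n)))) ∧
      ∀ᵐ x ∂(cellMeasure b),
        (fun n => equivalentStrain (e n x))
            =O[atTop] (fun n => contrast b κ₀ μ₀ (κ n) (μ n))) := by
  have hd0 : d ≠ 0 := by omega
  obtain ⟨a, ha, rfl⟩ : ∃ a : ℝ, a ≠ 0 ∧ ebar = a • 1 := by
    refine ⟨ebar.trace / d, fun h => hne ?_, hsph.symm⟩
    rw [← hsph, sph, h, zero_smul]
  simp only [bulkFromHydrostatic_eq hd0 ha, and_self]
  obtain ⟨C, r, hC, hr, hest⟩ := exists_fluctuation_estimates b hd0 hκ₀ hμ₀ ha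
  have hsub : ∀ {κ : Space d → ℝ} (c : ℝ), LpPer b ⊤ κ →
      MemLp (fun x => κ x - c) ⊤ (cellMeasure b) := fun c h => h.2.sub (memLp_const c)
  refine ⟨⟨fun η hη => ?_, ?_⟩, ?_⟩
  -- The error is at most `C q ^ 2` with `q` the contrast, and `q ≤ η / (C + 1)` makes this at most
  -- `η q`.
  · refine ⟨min r (η / (C + 1)), lt_min hr (by positivity), fun κ μ e hmed hint hle he => ?_⟩
    have hint' : ∫ x, (κ x - κ₀) ∂(cellMeasure b) = 0 := by
      rw [integral_sub (hmed.1.2.integrable le_top) (integrable_const _), hint]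
      simp
    obtain ⟨F, hF, hFle⟩ := (hest (fun x => κ x - κ₀) (fun x => μ x - μ₀) κ μ e
      (hsub _ hmed.1) (hsub _ hmed.2.1) (fun x => by ring) (fun x => by ring)
      (hle.trans (min_le_left _ _)) he).2 hint'
    rw [hF.eLpNorm_eq]
    refine ENNReal.ofReal_le_ofReal (hFle.trans ?_)
    have h0 := contrast_nonneg (b := b) κ₀ μ₀ κ μ
    have h1 := hle.trans (min_le_right _ _)
    rw [le_div_iff₀ (by positivity)] at h1
    nlinarith
  · refine ⟨(1 + d ^ 2) * (d * (d * C)), r, hr, fun κ μ e hmed hle he => ?_⟩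
    have h1 := (hest (fun x => κ x - κ₀) (fun x => μ x - μ₀) κ μ e
      (hsub _ hmed.1) (hsub _ hmed.2.1) (fun x => by ring) (fun x => by ring) hle he).1
    choose F hF hFle using h1
    have h0 := contrast_nonneg (b := b) κ₀ μ₀ κ μ
    set q := contrast b κ₀ μ₀ κ μ
    set f : Fin d × Fin d → Space d → ℝ := fun p x => |(e x - a • (1 : Tensor2 d)) p.1 p.2| with hf
    have hmem : ∀ p, MemLp (f p) 2 (cellMeasure b) := fun p => (hF p.1 p.2).memLp.norm
    have hfle : ∀ p, eLpNorm (f p) 2 (cellMeasure b) ≤ ENNReal.ofReal (C * q) := fun p => by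
      have := eLpNorm_norm (fun x => (e x - a • (1 : Tensor2 d)) p.1 p.2) (p := 2)
        (μ := cellMeasure b)
      simp only [Real.norm_eq_abs] at this
      rw [hf, this, (hF p.1 p.2).eLpNorm_eq]
      exact ENNReal.ofReal_le_ofReal (hFle _ _)
    calc eLpNorm (fun x => equivalentStrain (e x)) 2 (cellMeasure b)
        ≤ eLpNorm ((1 + (d : ℝ) ^ 2) • ∑ p, f p) 2 (cellMeasure b) := by
          refine eLpNorm_mono_real fun x => ?_
          rw [Pi.smul_apply, Finset.sum_apply, smul_eq_mul, hf, Fintype.sum_prod_type]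
          exact abs_equivalentStrain_le hd0 a (e x)
      _ ≤ ENNReal.ofReal (1 + (d : ℝ) ^ 2) * ∑ p : Fin d × Fin d, ENNReal.ofReal (C * q) := by
          rw [eLpNorm_const_smul, ← ofReal_norm, Real.norm_of_nonneg (by positivity)]
          gcongr
          exact (eLpNorm_sum_le (fun p _ => (hmem p).1) (by norm_num)).trans
            (Finset.sum_le_sum fun p _ => hfle p)
      _ = ENNReal.ofReal ((1 + d ^ 2) * (d * (d * C)) * q) := by
          rw [← ENNReal.ofReal_sum_of_nonneg fun _ _ => by positivity,
            ← ENNReal.ofReal_mul (by positivity)]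
          congr 1
          simp only [Finset.sum_const, Finset.card_univ, Fintype.card_prod, Fintype.card_fin,
            nsmul_eq_mul, Nat.cast_mul]
          ring
  · intro k m t κ μ e hk hm ht hκ hμ he
    set M := contrast b κ₀ μ₀ (fun x => κ₀ + k x) (fun x => μ₀ + m x) with hM
    have hcon : ∀ n, contrast b κ₀ μ₀ (κ n) (μ n) = |t n| * M := fun n =>
      contrast_scaled (hκ n) (hμ n)
    simp only [hcon]
    have hM' : 0 ≤ M := contrast_nonneg _ _ _ _
    -- If the contrast vanishes, the asymptotics demand exact equalities; the `L²` estimates at zero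
    -- contrast supply them.
    rcases hM'.eq_or_lt with hM0 | hM0
    · simp only [← hM0, mul_zero] at hcon ⊢
      have hn := fun n => hest (fun x => t n * k x) (fun x => t n * m x) (κ n) (μ n) (e n)
        (hk.2.const_mul _) (hm.2.const_mul _) (hκ n) (hμ n) (by rw [hcon]; exact hr.le) (he n)
      simp only [hcon, mul_zero, ne_eq, OfNat.ofNat_ne_zero, not_false_eq_true, zero_pow,
        norm_le_zero_iff] at hn
      have hzero : ∀ {f : Space d → ℝ}, (∃ F : CField b, Represents b F f ∧ F = 0) →
          ∀ᵐ x ∂(cellMeasure b), f x = 0 := by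
        rintro f ⟨F, hF, rfl⟩
        filter_upwards [hF, Lp.coeFn_zero ℂ 2 (cellMeasure b)] with x h1 h2
        rw [h2, Pi.zero_apply] at h1
        exact_mod_cast h1.symm
      refine ⟨fun hint => ?_, ?_⟩
      · have h1 : ∀ᵐ x ∂(cellMeasure b), ∀ n,
            κ n x - bulkFromTrace κ₀ μ₀ (a • 1) (e n x) = 0 :=
          ae_all_iff.mpr fun n => hzero ((hn n).2 (by rw [integral_const_mul, hint, mul_zero]))
        filter_upwards [h1] with x hx
        simp only [hx]
        exact isLittleO_zero _ _
      · have h1 : ∀ᵐ x ∂(cellMeasure b), ∀ n i j, (e n x - a • (1 : Tensor2 d)) i j = 0 :=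
          ae_all_iff.mpr fun n => ae_all_iff.mpr fun i => ae_all_iff.mpr fun j =>
            hzero ((hn n).1 i j)
        filter_upwards [h1] with x hx
        have h2 : ∀ n, equivalentStrain (e n x) = 0 := fun n => by
          have := abs_equivalentStrain_le hd0 a (e n x)
          simp only [hx, abs_zero, Finset.sum_const_zero, mul_zero] at this
          exact abs_nonpos_iff.mp this
        simp only [h2]
        exact isBigO_zero _ _
    · obtain ⟨s, B, G, hs, hpt⟩ := exists_pointwise_bounds (b := b) hd0 hκ₀ hμ₀ ha hk.2 hm.2
      have hev : ∀ᶠ n in atTop, |t n| ≤ s := by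
        have := ht.abs
        rw [abs_zero] at this
        exact this.eventually_le_const hs
      -- The null set depends on the solution, but a sequence of solutions needs only countably
      -- many.
      have hall : ∀ᵐ x ∂(cellMeasure b), ∀ n, |t n| ≤ s →
          (∀ i j, |(e n x - a • (1 : Tensor2 d)) i j| ≤ |t n| * B x) ∧
          (∫ x, k x ∂(cellMeasure b) = 0 →
            |κ n x - bulkFromTrace κ₀ μ₀ (a • 1) (e n x)| ≤ t n ^ 2 * G x) := by
        refine ae_all_iff.mpr fun n => ?_
        by_cases hts : |t n| ≤ s
        · exact (hpt (t n) (κ n) (μ n) (e n) hts (hκ n) (hμ n) (he n)).mono fun x hx _ => hx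
        · exact Eventually.of_forall fun x h => absurd h hts
      refine ⟨fun hint => ?_, ?_⟩
      · filter_upwards [hall] with x hx
        have h1 : (fun n => κ n x - bulkFromTrace κ₀ μ₀ (a • 1) (e n x))
            =O[atTop] fun n => t n * t n := by
          refine IsBigO.of_bound (G x) ?_
          filter_upwards [hev] with n hn
          have := (hx n hn).2 hint
          rw [Real.norm_eq_abs, Real.norm_eq_abs, abs_mul_self, ← sq, mul_comm]
          exact this
        have h2 : (fun n => t n * t n) =o[atTop] fun n => |t n| * M := by
          have h3 : t =o[atTop] fun _ => M := by
            rw [isLittleO_const_iff hM0.ne']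
            exact ht
          have h4 : t =O[atTop] fun n => |t n| := (isBigO_refl t atTop).abs_right
          exact h4.mul_isLittleO h3
        exact h1.trans_isLittleO h2
      · filter_upwards [hall] with x hx
        refine IsBigO.of_bound ((1 + d ^ 2) * (d * (d * B x)) / M) ?_
        filter_upwards [hev] with n hn
        rw [Real.norm_eq_abs, Real.norm_of_nonneg (by positivity)]
        refine (abs_equivalentStrain_le hd0 a (e n x)).trans ?_
        have h1 : ∑ i, ∑ j, |(e n x - a • (1 : Tensor2 d)) i j| ≤ d * (d * (|t n| * B x)) := by
          refine (Finset.sum_le_sum fun i _ => Finset.sum_le_sum fun j _ => (hx n hn).1 i j).trans ?_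
          simp
        calc _ ≤ (1 + (d : ℝ) ^ 2) * (d * (d * (|t n| * B x))) := by gcongr
          _ = _ := by field_simp
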